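/- For $n\ge 0$ let $\delta_n=(n-1,n-2,\dots,1)$ be the staircase partition, identified with its Young diagram. For partitions $\mu\subset\lambda$, an excited move replaces, in a set $D$ of squares of $\lambda$, a square $(i,j)\in D$ by $(i+1,j+1)$, provided that $(i+1,j),(i,j+1),(i+1,j+1)\notin D$ and $(i+1,j+1)\in\lambda$. An excited diagram of $\lambda/\mu$ is a set of squares obtained from $\mu$ by a (possibly empty) sequence of excited moves, a pleasant diagram of $\lambda/\mu$ is a subset of $\lambda\setminus D$ for some excited diagram $D$ of $\lambda/\mu$, and $p(\lambda/\mu)$ is the number of pleasant diagrams of $\lambda/\mu$. Let $s_m$ be the little Schröder number, indexed so that $(s_1,s_2,s_3,s_4,\dots)=(1,3,11,45,\dots)$ (the number of lattice paths from $(0,0)$ to $(2m,0)$ with steps $(1,1)$, $(1,-1)$, $(2,0)$ that never go below the $x$-axis and have no horizontal step on it), and put $\mathfrak{s}_m=2^{m+2}s_m$. A Dyck path from $(-m,0)$ to $(m,0)$ is a lattice path with steps $(1,1)$ and $(1,-1)$ that never goes below the $x$-axis; write $D(x)$ for the height of $D$ at the integer $x\in[-m,m]$. A valley of $D$ is a point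 $(x,D(x))$ with $-m<x<m$ and $D(x-1)>D(x)<D(x+1)$, and $v(D)$ is the number of valleys of $D$. For Dyck paths $D$ from $(-m,0)$ to $(m,0)$ and $E$ from $(-m',0)$ to $(m',0)$ with $m\le m'$, write $D<E$ if $D(x)<E(x)$ for all integers $-m\le x\le m$. Put $$d_m(q)=\sum_{D} q^{v(D)},\qquad d_{n,k}(q)=\sum_{D_1<D_2<\dots<D_k} q^{v(D_1)+\dots+v(D_k)},$$ where $D$ runs over all Dyck paths from $(-m,0)$ to $(m,0)$, and $(D_1,\dots,D_k)$ runs over all tuples with $D_1<\dots<D_k$ in which $D_i$ is a Dyck path from $(-n-2i+2,0)$ to $(n+2i-2,0)$. **Theorem.** For all integers $n\ge 1$ and $k\ge 0$ (an empty determinant being $1$): 1. $\displaystyle p(\delta_{n+2k}/\delta_n)=2^{\binom k2}\det\left(\mathfrak{s}_{n-2+i+j}\right)_{i,j=1}^k ;$ 2. $\displaystyle \det\left(d_{n+i+j-2}(q)\right)_{i,j=1}^k=q^{\binom k2}\,d_{n,k}(q)$, as polynomials in $q$. -/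

import Mathlib

/-- The staircase partition `(n - 1, n - 2, …, 1)` as a Young diagram. Rows and columns are
numbered from `0`, so row `i` consists of the cells `(i, j)` with `j < n - 1 - i`. -/
def staircase (n : ℕ) : YoungDiagram where
  cells := (Finset.range n ×ˢ Finset.range n).filter fun c => c.1 + c.2 + 1 < n
  isLowerSet := by
    rintro ⟨a, b⟩ ⟨c, d⟩ ⟨hc, hd⟩ h
    simp only [Finset.coe_filter, Finset.mem_product, Finset.mem_range, Set.mem_ofPred_eq] at *
    omega

theorem mem_staircase {n : ℕ} {c : ℕ × ℕ} : c ∈ staircase n ↔ c.1 + c.2 + 1 < n := by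
  rw [← YoungDiagram.mem_cells]
  simp only [staircase, Finset.mem_filter, Finset.mem_product, Finset.mem_range]
  omega

theorem rowLen_staircase (n i : ℕ) : (staircase n).rowLen i = n - 1 - i := by
  refine eq_of_forall_lt_iff fun j => ?_
  rw [← YoungDiagram.mem_iff_lt_rowLen, mem_staircase]
  omega

/-- `D'` arises from the set of squares `D` by one excited move inside `lam`: a square `(i, j)`
of `D` is replaced by `(i + 1, j + 1)`. -/
def ExcitedMove (lam : YoungDiagram) (D D' : Finset (ℕ × ℕ)) : Prop :=
  ∃ i j : ℕ, (i, j) ∈ D ∧ (i + 1, j) ∉ D ∧ (i, j + 1) ∉ D ∧ (i + 1, j + 1) ∉ D ∧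
    (i + 1, j + 1) ∈ lam ∧ D' = insert (i + 1, j + 1) (D.erase (i, j))

/-- The excited diagrams of the skew shape `lam / mu`: the sets of squares obtained from `mu` by
a (possibly empty) sequence of excited moves inside `lam`. -/
def IsExcitedDiagram (lam mu : YoungDiagram) (D : Finset (ℕ × ℕ)) : Prop :=
  Relation.ReflTransGen (ExcitedMove lam) mu.cells D

/-- The pleasant diagrams of `lam / mu`: the subsets of `lam \ D`, for `D` an excited diagram. -/
def IsPleasantDiagram (lam mu : YoungDiagram) (P : Finset (ℕ × ℕ)) : Prop :=
  ∃ D : Finset (ℕ × ℕ), IsExcitedDiagram lam mu D ∧ P ⊆ lam.cells \ D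

open Classical in
/-- The finite set of all pleasant diagrams of `lam / mu`. -/
noncomputable def pleasantDiagrams (lam mu : YoungDiagram) : Finset (Finset (ℕ × ℕ)) :=
  lam.cells.powerset.filter (IsPleasantDiagram lam mu)

theorem mem_pleasantDiagrams {lam mu : YoungDiagram} {P : Finset (ℕ × ℕ)} :
    P ∈ pleasantDiagrams lam mu ↔ IsPleasantDiagram lam mu P := by
  classical
  simp only [pleasantDiagrams, Finset.mem_filter, Finset.mem_powerset, and_iff_right_iff_imp]
  rintro ⟨D, -, hP⟩
  exact hP.trans Finset.sdiff_subset

/-- The number `p(lam / mu)` of pleasant diagrams. -/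
noncomputable def numPleasant (lam mu : YoungDiagram) : ℕ := (pleasantDiagrams lam mu).card

/-- The little Schröder number `s_m` in the indexing `s_0, s_1, s_2, s_3, … = 1, 1, 3, 11, …`, in
which `s_m` counts the lattice paths from `(0, 0)` to `(2 * m, 0)` with steps `(1, 1)`, `(1, -1)`,
`(2, 0)` that stay weakly above the `x`-axis and have no horizontal step on it. Mathlib's
sequence `Nat.smallSchroder = 1, 1, 1, 3, 11, …` is shifted by one. -/
def littleSchroder (m : ℕ) : ℕ := Nat.smallSchroder (m + 1)

theorem littleSchroder_values : littleSchroder 0 = 1 ∧ littleSchroder 1 = 1 ∧ littleSchroder 2 = 3 ∧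
    littleSchroder 3 = 11 := by
  have h : Nat.smallSchroder 3 = 3 := by simp [Nat.smallSchroder]
  refine ⟨Nat.smallSchroder_one, by simp [littleSchroder, Nat.smallSchroder], h, ?_⟩
  rw [littleSchroder, Nat.smallSchroder_succ (by norm_num), h]
  rw [show Finset.Ioo 0 (3 - 1) = {1} from rfl]
  simp [Nat.smallSchroder]

/-- `𝔰_m = 2 ^ (m + 2) * s_m`. -/
def scaledSchroder (m : ℕ) : ℕ := 2 ^ (m + 2) * littleSchroder m

/-- A Dyck path from `(-n, 0)` to `(n, 0)`: a path of up steps `(1, 1)` and down steps `(1, -1)`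
that never goes below the `x`-axis. It is given by its height at each `x`; outside the
interval `[-n, n]`, where there is no path, the height is `0` by convention. -/
@[ext]
structure DyckPath (n : ℕ) where
  height : ℤ → ℕ
  height_eq_zero : ∀ x : ℤ, (n : ℤ) ≤ |x| → height x = 0
  step : ∀ x : ℤ, -(n : ℤ) ≤ x → x < n →
    height (x + 1) = height x + 1 ∨ height x = height (x + 1) + 1

namespace DyckPath

/-- A Dyck path is determined by the positions of its up steps. -/
theorem upSteps_injective (n : ℕ) : Function.Injective fun D : DyckPath n =>
    (Finset.Ico (-(n : ℤ)) n).filter fun x => D.height (x + 1) = D.height x + 1 := by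
  intro D E h
  have key : ∀ m : ℕ, m ≤ 2 * n → D.height (-(n : ℤ) + m) = E.height (-(n : ℤ) + m) := by
    intro m
    induction m with
    | zero =>
      intro _
      rw [D.height_eq_zero _ (by simp), E.height_eq_zero _ (by simp)]
    | succ m ih =>
      intro hm
      have e := ih (by omega)
      have hx := Finset.ext_iff.mp h (-(n : ℤ) + m)
      simp only [Finset.mem_filter, Finset.mem_Ico] at hx
      have hD := D.step (-(n : ℤ) + m) (by omega) (by omega)
      have hE := E.step (-(n : ℤ) + m) (by omega) (by omega)
      have hr : -(n : ℤ) ≤ -(n : ℤ) + m ∧ -(n : ℤ) + m < n := by omega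
      simp only [hr, and_self, true_and] at hx
      push_cast
      rw [← add_assoc]
      omega
  ext x
  by_cases hx : (n : ℤ) ≤ |x|
  · rw [D.height_eq_zero x hx, E.height_eq_zero x hx]
  · obtain ⟨h1, h2⟩ := abs_lt.mp (not_le.mp hx)
    have := key (x + n).toNat (by omega)
    rwa [show -(n : ℤ) + ((x + n).toNat : ℤ) = x by omega] at this

instance (n : ℕ) : Finite (DyckPath n) :=
  Finite.of_injective
    (fun D : DyckPath n => (⟨_, Finset.mem_powerset.mpr (Finset.filter_subset
      (fun x => D.height (x + 1) = D.height x + 1) (Finset.Ico (-(n : ℤ)) n))⟩ :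
        (Finset.Ico (-(n : ℤ)) n).powerset))
    fun _ _ h => upSteps_injective n (congrArg Subtype.val h)

noncomputable instance (n : ℕ) : Fintype (DyckPath n) := Fintype.ofFinite _

/-- The `x`-coordinates of the valleys of a Dyck path. -/
noncomputable def valleys {n : ℕ} (D : DyckPath n) : Finset ℤ :=
  (Finset.Ioo (-(n : ℤ)) n).filter fun x =>
    D.height x < D.height (x - 1) ∧ D.height x < D.height (x + 1)

/-- `D < E`: over the whole interval of definition of `D`, the path `E` is strictly above `D`. -/
def StrictlyBelow {m n : ℕ} (D : DyckPath m) (E : DyckPath n) : Prop :=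
  ∀ x : ℤ, -(m : ℤ) ≤ x → x ≤ m → D.height x < E.height x

end DyckPath

/-- `d_n(q)`, the sum of `q ^ #valleys` over the Dyck paths from `(-n, 0)` to `(n, 0)`, as a
polynomial in `q`. -/
noncomputable def dyckPoly (n : ℕ) : Polynomial ℤ :=
  ∑ D : DyckPath n, Polynomial.X ^ D.valleys.card

open Classical in
/-- The tuples `D_1 < D_2 < … < D_k` of Dyck paths, where `D_i` goes from `(-(n + 2 * i - 2), 0)`
to `(n + 2 * i - 2, 0)` (in the code, the index `i : Fin k` starts at `0`). -/
noncomputable def nonIntersectingDyckPaths (n k : ℕ) :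
    Finset ((i : Fin k) → DyckPath (n + 2 * (i : ℕ))) :=
  Finset.univ.filter fun D => ∀ i j : Fin k, i < j → (D i).StrictlyBelow (D j)

/-- `d_{n,k}(q)`, the sum of `q ^ #valleys` over the tuples of non-intersecting Dyck paths,
`#valleys` being the total number of valleys of the `k` paths. -/
noncomputable def nonIntersectingDyckPoly (n k : ℕ) : Polynomial ℤ :=
  ∑ D ∈ nonIntersectingDyckPaths n k, Polynomial.X ^ (∑ i : Fin k, (D i).valleys.card)

/-!
Both identities are obtained by translating everything into *fillings* of the staircase `δ_n`:
weakly increasing arrays with entries in `[0, k]`.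

*Pleasant diagrams.* An excited diagram of `δ_{n+2k} / δ_n` is the same as a filling `f`, whose entry
records how far a square has moved along its diagonal. Among the excited diagrams that avoid a
given set `P` there is a least one, and it is characterised by `P` containing `jumpCells n f`,
one square for each unit of the jumps of `f` from the largest preceding entry. So the pleasant
diagrams fall into Boolean intervals, one for each filling (`numPleasant_eq_sum`), and their number
is a power of `2` times `∑ f, (1 / 2) ^ innerJumps n f`.

*Nested Dyck paths.* Counting the paths above each cell turns nested families of Dyck paths into
fillings (`sum_nonIntersectingDyckPaths`). The total number of valleys becomes the sum `outerDrops`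
of the drops from the smallest succeeding entry, and the total number of down steps in even position
becomes the alternating sum of the antidiagonals.

*Equidistribution.* These three statistics have the same distribution. For `innerJumps` and
`outerDrops` this is Stanley's transfer between order and chain polytopes (`sum_pow_innerJumps`):
both turn a filling into an array whose sums along chains are at most `k`. For `innerJumps` and the
alternating sum it is a form of the Robinson–Schensted–Knuth correspondence: toggling every other
antidiagonal trades the alternating sum for the jumps on the outermost antidiagonal plus the
alternating sum of a filling of `δ_{n-1}` (`sum_pow_alternatingSum`).

*Determinants.* Unlike valleys, down steps in even position are a local weight. Their generating
function is that of `k` ordered particles on `ℕ` which in turn stay or go down (with weight `q`) and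
stay or go up. Expanding a minor of walk weights one half step at a time shows that this generating
function is a `k × k` determinant (`walkMinor_eq_sum`). For `k = 1` it is the valley polynomial, so
that the Hankel matrix of valley polynomials factors through this minor and a triangular matrix with
determinant `q ^ (k.choose 2)` (`det_hankel_walkWeight`).

*Schröder numbers.* At `q = 1 / 2` the recurrence for walks returning to `0` is the one for little
Schröder numbers (`littleSchroder_eq_walkWeight`), and the powers of `2` cancel.
-/

/-! ### Fillings of the staircase -/

/-- A filling of the staircase `δ_n` by integers in `[0, k]`, weakly increasing along rows and
columns. The cell `(a, b)` of `staircase n` carries the entry `f (a + 1) (b + 1)`; all other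
entries are `0`, so that the entry above or to the left of a cell is always defined. -/
structure IsFilling (n k : ℕ) (f : ℕ → ℕ → ℕ) : Prop where
  zero_left : ∀ j, f 0 j = 0
  zero_right : ∀ i, f i 0 = 0
  zero_out : ∀ i j, n < i + j → f i j = 0
  mono_left : ∀ i j, i + 1 + j ≤ n → f i j ≤ f (i + 1) j
  mono_right : ∀ i j, i + (j + 1) ≤ n → f i j ≤ f i (j + 1)
  le_bound : ∀ i j, f i j ≤ k

theorem finite_isFilling (n k : ℕ) : {f | IsFilling n k f}.Finite := by
  refine Set.finite_coe_iff.mp (Finite.of_injective (β := Fin (n + 1) → Fin (n + 1) → Fin (k + 1))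
    (fun f i j => ⟨f.1 i j, Nat.lt_succ_of_le (f.2.le_bound i j)⟩) fun f g h => ?_)
  ext i j
  by_cases hij : n < i + j
  · rw [f.2.zero_out i j hij, g.2.zero_out i j hij]
  · have := congrFun (congrFun h ⟨i, by omega⟩) ⟨j, by omega⟩
    simpa using this

/-- The finite set of fillings of `δ_n` by integers in `[0, k]`. -/
noncomputable def fillings (n k : ℕ) : Finset (ℕ → ℕ → ℕ) := (finite_isFilling n k).toFinset

theorem mem_fillings {n k : ℕ} {f : ℕ → ℕ → ℕ} : f ∈ fillings n k ↔ IsFilling n k f := by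
  simp [fillings]

/-- The larger of the entries directly above and directly to the left of the cell `c`. -/
def innerMax (f : ℕ → ℕ → ℕ) (c : ℕ × ℕ) : ℕ := max (f c.1 (c.2 + 1)) (f (c.1 + 1) c.2)

/-- The sum over all cells of the jump from the largest preceding entry. -/
def innerJumps (n : ℕ) (f : ℕ → ℕ → ℕ) : ℕ :=
  ∑ c ∈ (staircase n).cells, (f (c.1 + 1) (c.2 + 1) - innerMax f c)

/-- The sum of the entries on the antidiagonals at even distance from the outermost one, minus
the sum of the other entries: each of the latter is subtracted from the entry below it. -/
def alternatingSum (n : ℕ) (f : ℕ → ℕ → ℕ) : ℕ :=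
  ∑ c ∈ (staircase n).cells with (c.1 + c.2) % 2 = n % 2,
    (f (c.1 + 1) (c.2 + 1) - f c.1 (c.2 + 1))

theorem sum_staircase {M : Type*} [AddCommMonoid M] (n : ℕ) (F : ℕ × ℕ → M) :
    ∑ c ∈ (staircase (n + 1)).cells, F c =
      ∑ m ∈ Finset.range n, ∑ c ∈ Finset.HasAntidiagonal.antidiagonal m, F c := by
  rw [← Finset.sum_fiberwise_of_maps_to (g := fun c : ℕ × ℕ => c.1 + c.2) (t := Finset.range n)]
  · refine Finset.sum_congr rfl fun m hm => Finset.sum_congr ?_ fun _ _ => rfl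
    ext c
    simp only [Finset.mem_filter, YoungDiagram.mem_cells, mem_staircase,
      Finset.HasAntidiagonal.mem_antidiagonal,
      Finset.mem_range] at *
    omega
  · intro c hc
    simp only [YoungDiagram.mem_cells, mem_staircase, Finset.mem_range] at *
    omega

/-- The sum of the entries on the `m`-th antidiagonal. -/
def diagSum (f : ℕ → ℕ → ℕ) (m : ℕ) : ℤ :=
  ∑ c ∈ Finset.HasAntidiagonal.antidiagonal m, (f (c.1 + 1) (c.2 + 1) : ℤ)

/-- `x (m - 1) - x (m - 2) + x (m - 3) - …`. -/
def altSum (x : ℕ → ℤ) : ℕ → ℤ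
  | 0 => 0
  | m + 1 => x m - altSum x m

namespace IsFilling

variable {n k : ℕ} {f : ℕ → ℕ → ℕ}

theorem sum_left (hf : IsFilling n k f) (m : ℕ) :
    ∑ c ∈ Finset.HasAntidiagonal.antidiagonal (m + 1), (f c.1 (c.2 + 1) : ℤ) = diagSum f m := by
  rw [Finset.Nat.sum_antidiagonal_succ]
  simp [hf.zero_left, diagSum]

theorem sum_right (hf : IsFilling n k f) (m : ℕ) :
    ∑ c ∈ Finset.HasAntidiagonal.antidiagonal (m + 1), (f (c.1 + 1) c.2 : ℤ) = diagSum f m := by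
  rw [Finset.Nat.sum_antidiagonal_succ']
  simp [hf.zero_right, diagSum]

theorem innerMax_le (hf : IsFilling n k f) {c : ℕ × ℕ} (hc : c.1 + c.2 + 1 < n) :
    innerMax f c ≤ f (c.1 + 1) (c.2 + 1) :=
  max_le (hf.mono_left _ _ (by omega)) (hf.mono_right _ _ (by omega))

theorem innerJumps_eq (hf : IsFilling (n + 1) k f) :
    (innerJumps (n + 1) f : ℤ) = ∑ m ∈ Finset.range n,
      (diagSum f m - ∑ c ∈ Finset.HasAntidiagonal.antidiagonal m, (innerMax f c : ℤ)) := by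
  rw [innerJumps, sum_staircase]
  push_cast
  refine Finset.sum_congr rfl fun m hm => ?_
  rw [diagSum, ← Finset.sum_sub_distrib]
  refine Finset.sum_congr rfl fun c hc => ?_
  rw [Finset.mem_range] at hm
  rw [Finset.HasAntidiagonal.mem_antidiagonal] at hc
  exact Nat.cast_sub (hf.innerMax_le (by omega))

theorem alternatingSum_eq (hf : IsFilling (n + 1) k f) :
    (alternatingSum (n + 1) f : ℤ) = altSum (diagSum f) n := by
  have key : ∀ N ≤ n, altSum (diagSum f) N = ∑ m ∈ Finset.range N,
      ∑ c ∈ Finset.HasAntidiagonal.antidiagonal m, (if (c.1 + c.2) % 2 = (N + 1) % 2 then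
        ((f (c.1 + 1) (c.2 + 1) - f c.1 (c.2 + 1) : ℕ) : ℤ) else 0) := by
    have row : ∀ N m, m < n → ∑ c ∈ Finset.HasAntidiagonal.antidiagonal m,
        (if (c.1 + c.2) % 2 = (N + 1) % 2 then
        ((f (c.1 + 1) (c.2 + 1) - f c.1 (c.2 + 1) : ℕ) : ℤ) else 0) =
        if m % 2 = (N + 1) % 2 then
          diagSum f m - ∑ c ∈ Finset.HasAntidiagonal.antidiagonal m, (f c.1 (c.2 + 1) : ℤ)
        else 0 := by
      intro N m hm
      split_ifs with h
      · rw [diagSum, ← Finset.sum_sub_distrib]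
        refine Finset.sum_congr rfl fun c hc => ?_
        rw [Finset.HasAntidiagonal.mem_antidiagonal] at hc
        rw [if_pos (by rw [hc, h]), Nat.cast_sub (hf.mono_left _ _ (by omega))]
      · refine Finset.sum_eq_zero fun c hc => ?_
        rw [Finset.HasAntidiagonal.mem_antidiagonal] at hc
        rw [if_neg (by rw [hc]; exact h)]
    intro N
    induction N using Nat.twoStepInduction with
    | zero => simp [altSum]
    | one => intro h1; simp [altSum, diagSum, hf.zero_left]
    | more N ih _ =>
      intro hN
      rw [Finset.sum_range_succ, Finset.sum_range_succ, row _ _ (by omega), row _ _ (by omega),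
        if_neg (by omega), if_pos (by omega), altSum, altSum, ih (by omega), hf.sum_left]
      have : (N + 2 + 1) % 2 = (N + 1) % 2 := by omega
      simp only [this]
      ring
  rw [key n le_rfl, alternatingSum, Finset.sum_filter, sum_staircase]
  push_cast
  rfl

end IsFilling

/-! ### Toggling: jumps against the alternating sum -/

/-- Replace the entries on the antidiagonals at even positive distance from the outermost one by
their mirror images in the interval that the neighbouring entries leave them. -/
def toggle (n : ℕ) (f : ℕ → ℕ → ℕ) (i j : ℕ) : ℕ :=
  if 1 ≤ i ∧ 1 ≤ j ∧ i + j + 2 ≤ n ∧ (i + j) % 2 = n % 2 then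
    min (f (i + 1) j) (f i (j + 1)) + max (f (i - 1) j) (f i (j - 1)) - f i j
  else f i j

/-- Delete the outermost antidiagonal of a filling of `δ_{n+1}`. -/
def truncate (n : ℕ) (f : ℕ → ℕ → ℕ) (i j : ℕ) : ℕ := if n < i + j then 0 else f i j

/-- The bijection of fillings which keeps the outermost antidiagonal, toggles, and proceeds
recursively with the remaining antidiagonals. -/
def toggleRec : ℕ → (ℕ → ℕ → ℕ) → ℕ → ℕ → ℕ
  | 0, f => f
  | n + 1, f => fun i j =>
      if i + j = n + 1 then f i j else toggleRec n (truncate n (toggle (n + 1) f)) i j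

namespace IsFilling

variable {n k : ℕ} {f : ℕ → ℕ → ℕ}

theorem toggle_eq (hf : IsFilling n k f) {i j : ℕ} (hi : 1 ≤ i) (hj : 1 ≤ j) (h : i + j + 2 ≤ n)
    (hp : (i + j) % 2 = n % 2) :
    toggle n f i j + f i j = min (f (i + 1) j) (f i (j + 1)) + max (f (i - 1) j) (f i (j - 1)) ∧
      max (f (i - 1) j) (f i (j - 1)) ≤ f i j ∧ f i j ≤ min (f (i + 1) j) (f i (j + 1)) := by
  have h1 := hf.mono_left i j (by omega)
  have h2 := hf.mono_right i j (by omega)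
  have h3 := hf.mono_left (i - 1) j (by omega)
  have h4 := hf.mono_right i (j - 1) (by omega)
  rw [Nat.sub_add_cancel hi] at h3
  rw [Nat.sub_add_cancel hj] at h4
  rw [toggle, if_pos ⟨hi, hj, h, hp⟩]
  omega

theorem toggle_of_not {i j : ℕ} (h : ¬ (1 ≤ i ∧ 1 ≤ j ∧ i + j + 2 ≤ n ∧ (i + j) % 2 = n % 2)) :
    _root_.toggle n f i j = f i j := if_neg h

protected theorem toggle (hf : IsFilling n k f) : IsFilling n k (toggle n f) where
  zero_left j := by rw [toggle_of_not (by omega), hf.zero_left]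
  zero_right i := by rw [toggle_of_not (by omega), hf.zero_right]
  zero_out i j h := by rw [toggle_of_not (by omega), hf.zero_out i j h]
  mono_left i j h := by
    by_cases h1 : 1 ≤ i ∧ 1 ≤ j ∧ i + j + 2 ≤ n ∧ (i + j) % 2 = n % 2
    · obtain ⟨a, b, c⟩ := hf.toggle_eq h1.1 h1.2.1 h1.2.2.1 h1.2.2.2
      rw [toggle_of_not (i := i + 1) (by omega)]
      omega
    · rw [toggle_of_not h1]
      by_cases h2 : 1 ≤ i + 1 ∧ 1 ≤ j ∧ i + 1 + j + 2 ≤ n ∧ (i + 1 + j) % 2 = n % 2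
      · obtain ⟨a, b, c⟩ := hf.toggle_eq h2.1 h2.2.1 h2.2.2.1 h2.2.2.2
        rw [Nat.add_sub_cancel] at a b
        omega
      · rw [toggle_of_not h2]
        exact hf.mono_left i j h
  mono_right i j h := by
    by_cases h1 : 1 ≤ i ∧ 1 ≤ j ∧ i + j + 2 ≤ n ∧ (i + j) % 2 = n % 2
    · obtain ⟨a, b, c⟩ := hf.toggle_eq h1.1 h1.2.1 h1.2.2.1 h1.2.2.2
      rw [toggle_of_not (j := j + 1) (by omega)]
      omega
    · rw [toggle_of_not h1]
      by_cases h2 : 1 ≤ i ∧ 1 ≤ j + 1 ∧ i + (j + 1) + 2 ≤ n ∧ (i + (j + 1)) % 2 = n % 2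
      · obtain ⟨a, b, c⟩ := hf.toggle_eq h2.1 h2.2.1 h2.2.2.1 h2.2.2.2
        rw [Nat.add_sub_cancel] at a b
        omega
      · rw [toggle_of_not h2]
        exact hf.mono_right i j h
  le_bound i j := by
    by_cases h1 : 1 ≤ i ∧ 1 ≤ j ∧ i + j + 2 ≤ n ∧ (i + j) % 2 = n % 2
    · obtain ⟨a, b, c⟩ := hf.toggle_eq h1.1 h1.2.1 h1.2.2.1 h1.2.2.2
      have := hf.le_bound (i + 1) j
      omega
    · rw [toggle_of_not h1]
      exact hf.le_bound i j

protected theorem truncate (hf : IsFilling (n + 1) k f) : IsFilling n k (truncate n f) where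
  zero_left j := by simp [truncate, hf.zero_left]
  zero_right i := by simp [truncate, hf.zero_right]
  zero_out i j h := if_pos h
  mono_left i j h := by
    rw [truncate, truncate, if_neg (by omega), if_neg (by omega)]
    exact hf.mono_left i j (by omega)
  mono_right i j h := by
    rw [truncate, truncate, if_neg (by omega), if_neg (by omega)]
    exact hf.mono_right i j (by omega)
  le_bound i j := by
    rw [truncate]
    split_ifs
    · exact Nat.zero_le k
    · exact hf.le_bound i j

theorem toggleRec_spec (n : ℕ) : ∀ f, IsFilling n k f →
    IsFilling n k (toggleRec n f) ∧ ∀ i j, i + j = n → toggleRec n f i j = f i j := by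
  induction n with
  | zero => exact fun f hf => ⟨hf, fun _ _ _ => rfl⟩
  | succ n ih =>
    intro f hf
    obtain ⟨hg, hd⟩ := ih _ hf.toggle.truncate
    refine ⟨?_, fun i j h => by simp [toggleRec, h]⟩
    -- the antidiagonal next to the outermost one is not toggled
    have hd' : ∀ i j, i + j = n → toggleRec n (truncate n (toggle (n + 1) f)) i j = f i j := by
      intro i j h
      rw [hd i j h, truncate, if_neg (by omega), toggle_of_not (by omega)]
    set g := toggleRec n (truncate n (toggle (n + 1) f)) with hgdef
    have e : toggleRec (n + 1) f = fun i j => if i + j = n + 1 then f i j else g i j := rfl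
    rw [e]
    constructor
    · intro j; simp [hf.zero_left, hg.zero_left]
    · intro j; simp [hf.zero_right, hg.zero_right]
    · intro i j h
      simp only [if_neg (show i + j ≠ n + 1 by omega)]
      exact hg.zero_out i j (by omega)
    · intro i j h
      simp only [if_neg (show i + j ≠ n + 1 by omega)]
      split_ifs with h1
      · rw [hd' i j (by omega)]
        exact hf.mono_left i j h
      · exact hg.mono_left i j (by omega)
    · intro i j h
      simp only [if_neg (show i + j ≠ n + 1 by omega)]
      split_ifs with h1
      · rw [hd' i j (by omega)]
        exact hf.mono_right i j h
      · exact hg.mono_right i j (by omega)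
    · intro i j
      split_ifs
      · exact hf.le_bound i j
      · exact hg.le_bound i j

theorem toggle_injective {f g : ℕ → ℕ → ℕ} (hf : IsFilling n k f) (hg : IsFilling n k g)
    (h : toggle n f = toggle n g) : f = g := by
  have untog : ∀ i j, ¬ (1 ≤ i ∧ 1 ≤ j ∧ i + j + 2 ≤ n ∧ (i + j) % 2 = n % 2) → f i j = g i j := by
    intro i j hij
    rw [← toggle_of_not (f := f) hij, h, toggle_of_not hij]
  funext i j
  by_cases h1 : 1 ≤ i ∧ 1 ≤ j ∧ i + j + 2 ≤ n ∧ (i + j) % 2 = n % 2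
  · obtain ⟨a, b, c⟩ := hf.toggle_eq h1.1 h1.2.1 h1.2.2.1 h1.2.2.2
    obtain ⟨a', b', c'⟩ := hg.toggle_eq h1.1 h1.2.1 h1.2.2.1 h1.2.2.2
    rw [h, untog (i + 1) j (by omega), untog i (j + 1) (by omega), untog (i - 1) j (by omega),
      untog i (j - 1) (by omega)] at a
    omega
  · exact untog i j h1

theorem toggleRec_injective (n : ℕ) : ∀ f g, IsFilling n k f → IsFilling n k g →
    toggleRec n f = toggleRec n g → f = g := by
  induction n with
  | zero => exact fun f g _ _ h => h
  | succ n ih =>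
    intro f g hf hg h
    have outer : ∀ i j, i + j = n + 1 → f i j = g i j := by
      intro i j hij
      have := congrFun (congrFun h i) j
      simpa [toggleRec, hij] using this
    have inner : toggleRec n (truncate n (toggle (n + 1) f)) =
        toggleRec n (truncate n (toggle (n + 1) g)) := by
      funext i j
      by_cases hij : i + j = n + 1
      · rw [(toggleRec_spec n _ hf.toggle.truncate).1.zero_out i j (by omega),
          (toggleRec_spec n _ hg.toggle.truncate).1.zero_out i j (by omega)]
      · have := congrFun (congrFun h i) j
        simpa [toggleRec, hij] using this
    have trunc := ih _ _ hf.toggle.truncate hg.toggle.truncate inner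
    refine toggle_injective hf hg ?_
    funext i j
    by_cases hij : n < i + j
    · rw [toggle_of_not (by omega), toggle_of_not (by omega)]
      by_cases hij' : i + j = n + 1
      · exact outer i j hij'
      · rw [hf.zero_out i j (by omega), hg.zero_out i j (by omega)]
    · have := congrFun (congrFun trunc i) j
      simpa [truncate, hij] using this

end IsFilling

/-- The telescoping that makes toggling work: `x` and `x'` are the antidiagonal sums before and
after toggling, `mx` and `mn` the antidiagonal sums of the bounds between which an entry is
reflected. -/
theorem altSum_toggle (x mx mn : ℕ → ℤ) (h0 : mx 0 = 0) (h1 : mx 1 = 2 * x 0)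
    (h2 : ∀ m, mx (m + 2) + mn m = 2 * x (m + 1)) (N : ℕ) : ∀ x' : ℕ → ℤ,
    (∀ m < N, (m + N) % 2 = 0 → x' m = mn m + mx m - x m) →
    (∀ m < N, (m + N) % 2 = 1 → x' m = x m) →
    altSum x (N + 1) = altSum x' N + (x N - mx N) := by
  induction N using Nat.twoStepInduction with
  | zero => intro x' _ _; simp [altSum, h0]
  | one =>
    intro x' _ h
    have := h 0 (by omega) (by omega)
    simp only [altSum]
    linarith
  | more N ih _ =>
    intro x' ha hb
    have e := ih x' (fun m hm hp => ha m (by omega) (by omega))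
      (fun m hm hp => hb m (by omega) (by omega))
    have e1 := hb (N + 1) (by omega) (by omega)
    have e2 := ha N (by omega) (by omega)
    have e3 := h2 N
    simp only [altSum] at *
    linarith

namespace IsFilling

variable {n k : ℕ} {f : ℕ → ℕ → ℕ}

/-- Removing the outermost antidiagonal after toggling changes the alternating sum by the jumps on
this antidiagonal. -/
theorem altSum_diagSum (hf : IsFilling (n + 2) k f) :
    altSum (diagSum f) (n + 1) = altSum (diagSum (truncate (n + 1) (toggle (n + 2) f))) n +
      (diagSum f n - ∑ c ∈ Finset.HasAntidiagonal.antidiagonal n, (innerMax f c : ℤ)) := by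
  refine altSum_toggle (diagSum f)
    (fun m => ∑ c ∈ Finset.HasAntidiagonal.antidiagonal m, (innerMax f c : ℤ))
    (fun m => ∑ c ∈ Finset.HasAntidiagonal.antidiagonal m,
      (min (f (c.1 + 2) (c.2 + 1)) (f (c.1 + 1) (c.2 + 2)) : ℤ)) ?_ ?_ ?_ n _ ?_ ?_
  · simp [innerMax, hf.zero_left, hf.zero_right]
  · simp [innerMax, hf.zero_left, hf.zero_right, diagSum, Finset.Nat.antidiagonal_succ]
    ring
  · intro m
    -- the smaller of two neighbours on the border of the staircase is `0`
    have e : ∑ c ∈ Finset.HasAntidiagonal.antidiagonal m,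
        (min (f (c.1 + 2) (c.2 + 1)) (f (c.1 + 1) (c.2 + 2)) : ℤ) =
        ∑ c ∈ Finset.HasAntidiagonal.antidiagonal (m + 2),
          (min (f c.1 (c.2 + 1)) (f (c.1 + 1) c.2) : ℤ) := by
      rw [Finset.Nat.sum_antidiagonal_succ, Finset.Nat.sum_antidiagonal_succ']
      simp [hf.zero_left, hf.zero_right, min_comm]
    simp only [e]
    rw [← Finset.sum_add_distrib, two_mul]
    nth_rewrite 1 [← hf.sum_left]
    rw [← hf.sum_right, ← Finset.sum_add_distrib]
    refine Finset.sum_congr rfl fun c _ => ?_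
    rw [innerMax, Nat.cast_max, max_add_min]
  · intro m hm hp
    rw [diagSum, diagSum, ← Finset.sum_add_distrib, ← Finset.sum_sub_distrib]
    refine Finset.sum_congr rfl fun c hc => ?_
    rw [Finset.HasAntidiagonal.mem_antidiagonal] at hc
    have := (hf.toggle_eq (i := c.1 + 1) (j := c.2 + 1) (by omega) (by omega) (by omega)
      (by omega)).1
    rw [truncate, if_neg (by omega), innerMax]
    simp only [Nat.add_sub_cancel, Nat.add_assoc, one_add_one_eq_two] at this
    rw [← Nat.cast_min]
    omega
  · intro m hm hp
    refine Finset.sum_congr rfl fun c hc => ?_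
    rw [Finset.HasAntidiagonal.mem_antidiagonal] at hc
    rw [truncate, if_neg (by omega), toggle_of_not (by omega)]

/-- The point of toggling: the jumps of the image add up to the alternating sum of the original.
The outermost antidiagonal contributes its jumps by `altSum_diagSum`, the others by induction. -/
theorem innerJumps_toggleRec (n : ℕ) : ∀ f, IsFilling n k f →
    innerJumps n (toggleRec n f) = alternatingSum n f := by
  induction n with
  | zero =>
    intro f _
    have : (staircase 0).cells = ∅ := by ext c; simp [mem_staircase]
    simp [innerJumps, alternatingSum, this]
  | succ n ih =>
    intro f hf
    have h := ih _ hf.toggle.truncate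
    zify at h ⊢
    rw [(toggleRec_spec _ _ hf).1.innerJumps_eq, hf.alternatingSum_eq]
    cases n with
    | zero => simp [altSum]
    | succ n =>
      have hg := (toggleRec_spec _ _ hf.toggle.truncate).1
      have hd := (toggleRec_spec _ _ hf.toggle.truncate).2
      rw [hg.innerJumps_eq, hf.toggle.truncate.alternatingSum_eq] at h
      rw [hf.altSum_diagSum, ← h, Finset.sum_range_succ]
      have e : ∀ i j, i + j ≠ n + 2 → toggleRec (n + 1 + 1) f i j =
          toggleRec (n + 1) (truncate (n + 1) (toggle (n + 1 + 1) f)) i j := by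
        intro i j hij
        simp [toggleRec, hij]
      congr 1
      · refine Finset.sum_congr rfl fun m hm => ?_
        rw [Finset.mem_range] at hm
        rw [diagSum, diagSum, ← Finset.sum_sub_distrib, ← Finset.sum_sub_distrib]
        refine Finset.sum_congr rfl fun c hc => ?_
        rw [Finset.HasAntidiagonal.mem_antidiagonal] at hc
        rw [innerMax, innerMax, e _ _ (by omega), e _ _ (by omega), e _ _ (by omega)]
      · rw [diagSum, diagSum, ← Finset.sum_sub_distrib, ← Finset.sum_sub_distrib]
        refine Finset.sum_congr rfl fun c hc => ?_
        rw [Finset.HasAntidiagonal.mem_antidiagonal] at hc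
        rw [innerMax, innerMax, e c.1 (c.2 + 1) (by omega), e (c.1 + 1) c.2 (by omega),
          (toggleRec_spec _ _ hf).2 _ _ (by omega), hd _ _ (by omega), hd _ _ (by omega)]
        simp only [truncate]
        rw [if_neg (by omega), if_neg (by omega), toggle_of_not (by omega),
          toggle_of_not (by omega)]

end IsFilling

theorem sum_fillings_eq_of_injective {M : Type*} [AddCommMonoid M] {n k : ℕ}
    (T : (ℕ → ℕ → ℕ) → ℕ → ℕ → ℕ) (hT : ∀ f, IsFilling n k f → IsFilling n k (T f))
    (hinj : ∀ f g, IsFilling n k f → IsFilling n k g → T f = T g → f = g)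
    (F : (ℕ → ℕ → ℕ) → M) : ∑ f ∈ fillings n k, F (T f) = ∑ f ∈ fillings n k, F f := by
  have hm : Set.MapsTo T (fillings n k : Set (ℕ → ℕ → ℕ)) (fillings n k) := by
    intro f hf
    rw [Finset.mem_coe, mem_fillings] at *
    exact hT f hf
  have hi : Set.InjOn T (fillings n k : Set (ℕ → ℕ → ℕ)) := by
    intro f hf g hg
    rw [Finset.mem_coe, mem_fillings] at *
    exact hinj f g hf hg
  exact Finset.sum_nbij T hm hi (Finset.surjOn_of_injOn_of_card_le T hm hi le_rfl) fun _ _ => rfl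

/-- The alternating sum and the sum of the jumps from inside are equidistributed. -/
theorem sum_pow_alternatingSum {R : Type*} [CommSemiring R] (q : R) (n k : ℕ) :
    ∑ f ∈ fillings n k, q ^ alternatingSum n f = ∑ f ∈ fillings n k, q ^ innerJumps n f := by
  rw [← sum_fillings_eq_of_injective (F := fun f => q ^ innerJumps n f) (toggleRec n)
    (fun f hf => (IsFilling.toggleRec_spec n f hf).1)
    (IsFilling.toggleRec_injective n)]
  refine Finset.sum_congr rfl fun f hf => ?_
  rw [IsFilling.innerJumps_toggleRec n f (mem_fillings.mp hf)]

/-! ### Transfer: jumps from inside against drops from outside -/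

/-- The entries of a filling, extended by the bound `k` beyond the outermost antidiagonal. -/
def extendBy (n k : ℕ) (f : ℕ → ℕ → ℕ) (i j : ℕ) : ℕ := if n < i + j then k else f i j

/-- The sum over all cells of the drop from the smallest succeeding entry, which is the bound `k`
for the cells of the outermost antidiagonal. -/
def outerDrops (n k : ℕ) (f : ℕ → ℕ → ℕ) : ℕ :=
  ∑ c ∈ (staircase n).cells,
    (min (extendBy n k f (c.1 + 2) (c.2 + 1)) (extendBy n k f (c.1 + 1) (c.2 + 2)) -
      f (c.1 + 1) (c.2 + 1))

/-- The largest sum of jumps of `f` along a chain of cells that starts in `(i, j)` and leads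
outwards. -/
def tailMax (n : ℕ) (f : ℕ → ℕ → ℕ) (i j : ℕ) : ℕ :=
  if n < i + j then 0
  else f i j - max (f (i - 1) j) (f i (j - 1)) + max (tailMax n f (i + 1) j) (tailMax n f i (j + 1))
termination_by n + 1 - (i + j)

/-- Stanley's transfer: the filling whose drops from outside are the jumps of `f` from inside. -/
def transfer (n k : ℕ) (f : ℕ → ℕ → ℕ) (i j : ℕ) : ℕ :=
  if 1 ≤ i ∧ 1 ≤ j ∧ i + j ≤ n then k - tailMax n f i j else 0

theorem tailMax_of_lt {n i j : ℕ} {f : ℕ → ℕ → ℕ} (h : n < i + j) : tailMax n f i j = 0 := by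
  rw [tailMax, if_pos h]

theorem tailMax_of_le {n i j : ℕ} {f : ℕ → ℕ → ℕ} (h : i + j ≤ n) : tailMax n f i j =
    f i j - max (f (i - 1) j) (f i (j - 1)) +
      max (tailMax n f (i + 1) j) (tailMax n f i (j + 1)) := by
  rw [tailMax, if_neg (by omega)]

namespace IsFilling

variable {n k : ℕ} {f : ℕ → ℕ → ℕ}

theorem max_pred_le (hf : IsFilling n k f) {i j : ℕ} (hi : 1 ≤ i) (hj : 1 ≤ j) (h : i + j ≤ n) :
    max (f (i - 1) j) (f i (j - 1)) ≤ f i j := by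
  have h3 := hf.mono_left (i - 1) j (by omega)
  have h4 := hf.mono_right i (j - 1) (by omega)
  rw [Nat.sub_add_cancel hi] at h3
  rw [Nat.sub_add_cancel hj] at h4
  exact max_le h3 h4

/-- A chain that leads to `(i, j)` and then outwards has total jump at most `k`, by induction on
the distance of `(i, j)` from the outermost antidiagonal. -/
theorem max_pred_add_tailMax_le (hf : IsFilling n k f) (d : ℕ) : ∀ i j, 1 ≤ i → 1 ≤ j →
    n + 1 ≤ i + j + d → max (f (i - 1) j) (f i (j - 1)) + tailMax n f i j ≤ k := by
  induction d with
  | zero =>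
    intro i j hi hj h
    rw [tailMax_of_lt (by omega)]
    exact max_le (hf.le_bound _ _) (hf.le_bound _ _)
  | succ d ih =>
    intro i j hi hj h
    by_cases hij : i + j ≤ n
    · have h1 := ih (i + 1) j (by omega) hj (by omega)
      have h2 := ih i (j + 1) hi (by omega) (by omega)
      have h3 := hf.max_pred_le hi hj hij
      rw [Nat.add_sub_cancel] at h1 h2
      rw [tailMax_of_le hij]
      omega
    · exact ih i j hi hj (by omega)

theorem tailMax_le (hf : IsFilling n k f) {i j : ℕ} (hi : 1 ≤ i) (hj : 1 ≤ j) :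
    tailMax n f i j ≤ k :=
  (Nat.le_add_left _ _).trans (hf.max_pred_add_tailMax_le (n + 1) i j hi hj (by omega))

protected theorem transfer (n k : ℕ) (f : ℕ → ℕ → ℕ) : IsFilling n k (transfer n k f) where
  zero_left j := if_neg (by omega)
  zero_right i := if_neg (by omega)
  zero_out i j h := if_neg (by omega)
  mono_left i j h := by
    by_cases hij : 1 ≤ i ∧ 1 ≤ j
    · rw [transfer, transfer, if_pos (by omega), if_pos (by omega),
        tailMax_of_le (i := i) (j := j) (by omega)]
      omega
    · rw [transfer, if_neg (by omega)]
      exact Nat.zero_le _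
  mono_right i j h := by
    by_cases hij : 1 ≤ i ∧ 1 ≤ j
    · rw [transfer, transfer, if_pos (by omega), if_pos (by omega),
        tailMax_of_le (i := i) (j := j) (by omega)]
      omega
    · rw [transfer, if_neg (by omega)]
      exact Nat.zero_le _
  le_bound i j := by
    rw [transfer]
    split_ifs
    · exact Nat.sub_le _ _
    · exact Nat.zero_le _

theorem extendBy_transfer {i j : ℕ} (hi : 1 ≤ i) (hj : 1 ≤ j) :
    extendBy n k (_root_.transfer n k f) i j = k - tailMax n f i j := by
  by_cases h : n < i + j
  · rw [extendBy, if_pos h, tailMax_of_lt h, Nat.sub_zero]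
  · rw [extendBy, if_neg h, _root_.transfer, if_pos (by omega)]

/-- The drop at a cell in the transferred filling is the jump at this cell in `f`. -/
theorem outerDrops_transfer (hf : IsFilling n k f) :
    outerDrops n k (_root_.transfer n k f) = innerJumps n f := by
  refine Finset.sum_congr rfl fun c hc => ?_
  rw [YoungDiagram.mem_cells, mem_staircase] at hc
  rw [extendBy_transfer (by omega) (by omega), extendBy_transfer (by omega) (by omega),
    _root_.transfer, if_pos (by omega)]
  have h1 := tailMax_of_le (n := n) (f := f) (i := c.1 + 1) (j := c.2 + 1) (by omega)
  have h2 := hf.tailMax_le (i := c.1 + 1) (j := c.2 + 1) (by omega) (by omega)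
  simp only [Nat.add_sub_cancel, Nat.add_assoc, one_add_one_eq_two] at h1
  rw [innerMax]
  omega

theorem transfer_injective {g : ℕ → ℕ → ℕ} (hf : IsFilling n k f) (hg : IsFilling n k g)
    (h : _root_.transfer n k f = _root_.transfer n k g) : f = g := by
  have ht : ∀ i j, 1 ≤ i → 1 ≤ j → tailMax n f i j = tailMax n g i j := by
    intro i j hi hj
    have e1 := extendBy_transfer (n := n) (k := k) (f := f) hi hj
    rw [h, extendBy_transfer hi hj] at e1
    have := hf.tailMax_le hi hj
    have := hg.tailMax_le hi hj
    omega
  have key : ∀ m i j, i + j = m → f i j = g i j := by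
    intro m
    induction m with
    | zero =>
      intro i j hij
      rw [show i = 0 by omega, hf.zero_left, hg.zero_left]
    | succ m ih =>
      intro i j hij
      rcases Nat.eq_zero_or_pos i with rfl | hi
      · rw [hf.zero_left, hg.zero_left]
      rcases Nat.eq_zero_or_pos j with rfl | hj
      · rw [hf.zero_right, hg.zero_right]
      by_cases hn : n < i + j
      · rw [hf.zero_out i j hn, hg.zero_out i j hn]
      have e := ht i j hi hj
      rw [tailMax_of_le (f := f) (i := i) (j := j) (by omega),
        tailMax_of_le (f := g) (i := i) (j := j) (by omega), ht (i + 1) j (by omega) hj,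
        ht i (j + 1) hi (by omega)] at e
      have e1 := ih (i - 1) j (by omega)
      have e2 := ih i (j - 1) (by omega)
      have e3 := hf.max_pred_le hi hj (by omega)
      have e4 := hg.max_pred_le hi hj (by omega)
      omega
  funext i j
  exact key _ i j rfl

end IsFilling

/-- The jumps from inside and the drops from outside are equidistributed. -/
theorem sum_pow_innerJumps {R : Type*} [CommSemiring R] (q : R) (n k : ℕ) :
    ∑ f ∈ fillings n k, q ^ innerJumps n f = ∑ f ∈ fillings n k, q ^ outerDrops n k f := by
  rw [← sum_fillings_eq_of_injective (F := fun f => q ^ outerDrops n k f) (transfer n k)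
    (fun f _ => IsFilling.transfer n k f) fun f g hf hg => hf.transfer_injective hg]
  refine Finset.sum_congr rfl fun f hf => ?_
  rw [(mem_fillings.mp hf).outerDrops_transfer]

/-! ### Excited and pleasant diagrams as fillings -/

/-- The entry of a filling in the cell `c`. -/
def entry (f : ℕ → ℕ → ℕ) (c : ℕ × ℕ) : ℕ := f (c.1 + 1) (c.2 + 1)

/-- The set of squares obtained from `δ_n` by moving each square `c` down its diagonal by
`entry f c` steps. -/
def excitedSet (n : ℕ) (f : ℕ → ℕ → ℕ) : Finset (ℕ × ℕ) :=
  (staircase n).cells.image fun c => (c.1 + entry f c, c.2 + entry f c)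

/-- The filling `f` with the entry in the cell `c` replaced by `v`. -/
def setEntry (f : ℕ → ℕ → ℕ) (c : ℕ × ℕ) (v : ℕ) (i j : ℕ) : ℕ :=
  if i = c.1 + 1 ∧ j = c.2 + 1 then v else f i j

/-- The squares which the squares of `δ_n` pass on the way to `excitedSet n f`, counted from the
first moment at which the preceding squares are out of the way. -/
def jumpCells (n : ℕ) (f : ℕ → ℕ → ℕ) : Finset (ℕ × ℕ) :=
  (staircase n).cells.biUnion fun c =>
    (Finset.Ico (innerMax f c) (entry f c)).image fun t => (c.1 + t, c.2 + t)

theorem mem_excitedSet {n : ℕ} {f : ℕ → ℕ → ℕ} {a b : ℕ} : (a, b) ∈ excitedSet n f ↔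
    ∃ c : ℕ × ℕ, c.1 + c.2 + 1 < n ∧ c.1 + entry f c = a ∧ c.2 + entry f c = b := by
  simp only [excitedSet, Finset.mem_image, YoungDiagram.mem_cells, mem_staircase, Prod.mk.injEq]

theorem mem_jumpCells {n : ℕ} {f : ℕ → ℕ → ℕ} {p : ℕ × ℕ} : p ∈ jumpCells n f ↔
    ∃ c : ℕ × ℕ, c.1 + c.2 + 1 < n ∧ ∃ t, (innerMax f c ≤ t ∧ t < entry f c) ∧
      (c.1 + t, c.2 + t) = p := by
  simp only [jumpCells, Finset.mem_biUnion, Finset.mem_image, YoungDiagram.mem_cells,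
    mem_staircase, Finset.mem_Ico]

theorem entry_setEntry_self (f : ℕ → ℕ → ℕ) (c : ℕ × ℕ) (v : ℕ) :
    entry (setEntry f c v) c = v := if_pos ⟨rfl, rfl⟩

theorem entry_setEntry_of_ne (f : ℕ → ℕ → ℕ) {c d : ℕ × ℕ} (h : d ≠ c) (v : ℕ) :
    entry (setEntry f c v) d = entry f d := by
  refine if_neg fun h' => h (Prod.ext ?_ ?_)
  · exact Nat.succ_injective h'.1
  · exact Nat.succ_injective h'.2

namespace IsFilling

variable {n k : ℕ} {f : ℕ → ℕ → ℕ}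

theorem mono (hf : IsFilling n k f) {i j i' j' : ℕ} (hi : i ≤ i') (hj : j ≤ j')
    (h : i' + j' ≤ n) : f i j ≤ f i' j' := by
  obtain ⟨s, rfl⟩ := Nat.exists_eq_add_of_le hi
  obtain ⟨t, rfl⟩ := Nat.exists_eq_add_of_le hj
  have row : ∀ s i j, i + s + j ≤ n → f i j ≤ f (i + s) j := by
    intro s
    induction s with
    | zero => exact fun i j _ => le_rfl
    | succ s ih =>
      exact fun i j h => (ih i j (by omega)).trans (hf.mono_left (i + s) j (by omega))
  have col : ∀ t i j, i + (j + t) ≤ n → f i j ≤ f i (j + t) := by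
    intro t
    induction t with
    | zero => exact fun i j _ => le_rfl
    | succ t ih =>
      exact fun i j h => (ih i j (by omega)).trans (hf.mono_right i (j + t) (by omega))
  exact (row s i j (by omega)).trans (col t _ j h)

theorem entry_mono (hf : IsFilling n k f) {c d : ℕ × ℕ} (h1 : c.1 ≤ d.1) (h2 : c.2 ≤ d.2)
    (hd : d.1 + d.2 + 1 < n) : entry f c ≤ entry f d :=
  hf.mono (by omega) (by omega) (by omega)

theorem entry_le_succ (hf : IsFilling n k f) {c : ℕ × ℕ} (hc : c.1 + c.2 + 2 < n) :
    entry f c ≤ f (c.1 + 2) (c.2 + 1) ∧ entry f c ≤ f (c.1 + 1) (c.2 + 2) :=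
  ⟨hf.mono_left (c.1 + 1) (c.2 + 1) (by omega), hf.mono_right (c.1 + 1) (c.2 + 1) (by omega)⟩

theorem shift_injective (hf : IsFilling n k f) {c d : ℕ × ℕ} (hc : c.1 + c.2 + 1 < n)
    (hd : d.1 + d.2 + 1 < n) (h1 : c.1 + entry f c = d.1 + entry f d)
    (h2 : c.2 + entry f c = d.2 + entry f d) : c = d := by
  rcases le_total c.1 d.1 with h | h
  · have := hf.entry_mono h (by omega) hd
    exact Prod.ext (by omega) (by omega)
  · have := hf.entry_mono h (by omega) hc
    exact Prod.ext (by omega) (by omega)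

protected theorem setEntry (hf : IsFilling n k f) {c : ℕ × ℕ} (hc : c.1 + c.2 + 1 < n) {v : ℕ}
    (hv : v ≤ k) (hin : innerMax f c ≤ v)
    (hout : c.1 + c.2 + 2 < n → v ≤ f (c.1 + 2) (c.2 + 1) ∧ v ≤ f (c.1 + 1) (c.2 + 2)) :
    IsFilling n k (setEntry f c v) where
  zero_left j := by rw [_root_.setEntry, if_neg (by omega), hf.zero_left]
  zero_right i := by rw [_root_.setEntry, if_neg (by omega), hf.zero_right]
  zero_out i j h := by rw [_root_.setEntry, if_neg (by omega), hf.zero_out i j h]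
  mono_left i j h := by
    have := hf.mono_left i j h
    rw [innerMax, max_le_iff] at hin
    rw [_root_.setEntry, _root_.setEntry]
    split_ifs with h1 h2 h2
    · omega
    · obtain ⟨rfl, rfl⟩ := h1
      exact (hout (by omega)).1
    · obtain ⟨h2, rfl⟩ := h2
      obtain rfl : i = c.1 := by omega
      exact hin.1
    · exact this
  mono_right i j h := by
    have := hf.mono_right i j h
    rw [innerMax, max_le_iff] at hin
    rw [_root_.setEntry, _root_.setEntry]
    split_ifs with h1 h2 h2
    · omega
    · obtain ⟨rfl, rfl⟩ := h1
      exact (hout (by omega)).2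
    · obtain ⟨rfl, h2⟩ := h2
      obtain rfl : j = c.2 := by omega
      exact hin.2
    · exact this
  le_bound i j := by
    rw [_root_.setEntry]
    split_ifs
    · exact hv
    · exact hf.le_bound i j

theorem excitedSet_setEntry_succ (hf : IsFilling n k f) {c : ℕ × ℕ} (hc : c.1 + c.2 + 1 < n) :
    excitedSet n (_root_.setEntry f c (entry f c + 1)) =
      insert (c.1 + entry f c + 1, c.2 + entry f c + 1)
        ((excitedSet n f).erase (c.1 + entry f c, c.2 + entry f c)) := by
  ext ⟨a, b⟩
  simp only [Finset.mem_insert, Finset.mem_erase, mem_excitedSet, Prod.mk.injEq, ne_eq]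
  constructor
  · rintro ⟨d, hd, h1, h2⟩
    by_cases hdc : d = c
    · subst hdc
      rw [entry_setEntry_self] at h1 h2
      exact Or.inl ⟨h1.symm, h2.symm⟩
    · rw [entry_setEntry_of_ne f hdc] at h1 h2
      refine Or.inr ⟨fun h => hdc (hf.shift_injective hd hc ?_ ?_), d, hd, h1, h2⟩
      · rw [h1, h.1]
      · rw [h2, h.2]
  · rintro (⟨rfl, rfl⟩ | ⟨hne, d, hd, h1, h2⟩)
    · exact ⟨c, hc, by rw [entry_setEntry_self]; rfl, by rw [entry_setEntry_self]; rfl⟩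
    · have hdc : d ≠ c := by
        rintro rfl
        exact hne ⟨h1.symm, h2.symm⟩
      exact ⟨d, hd, by rwa [entry_setEntry_of_ne f hdc], by rwa [entry_setEntry_of_ne f hdc]⟩

theorem zero (n k : ℕ) : IsFilling n k fun _ _ => 0 := by
  constructor <;> simp

end IsFilling

/-- An excited diagram is described by how far each square has moved. The free neighbours required
by an excited move are exactly what keeps these distances weakly increasing. -/
theorem IsExcitedDiagram.exists_filling {n k : ℕ} {D : Finset (ℕ × ℕ)}
    (hD : IsExcitedDiagram (staircase (n + 2 * k)) (staircase n) D) :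
    ∃ f, IsFilling n k f ∧ D = excitedSet n f := by
  induction hD with
  | refl =>
    refine ⟨_, IsFilling.zero n k, ?_⟩
    simp [excitedSet, entry]
  | tail _ hmove ih =>
    obtain ⟨f, hf, rfl⟩ := ih
    obtain ⟨i, j, hij, hi, hj, -, hlam, rfl⟩ := hmove
    obtain ⟨c, hc, rfl, rfl⟩ := mem_excitedSet.mp hij
    rw [mem_staircase] at hlam
    have hout : c.1 + c.2 + 2 < n → entry f c + 1 ≤ f (c.1 + 2) (c.2 + 1) ∧
        entry f c + 1 ≤ f (c.1 + 1) (c.2 + 2) := by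
      intro h
      obtain ⟨h1, h2⟩ := hf.entry_le_succ h
      rw [mem_excitedSet] at hi hj
      constructor
      · refine lt_of_le_of_ne h1 fun e => hi ⟨(c.1 + 1, c.2), by simp only; omega, ?_, ?_⟩
        · change c.1 + 1 + f (c.1 + 2) (c.2 + 1) = _
          omega
        · change c.2 + f (c.1 + 2) (c.2 + 1) = _
          omega
      · refine lt_of_le_of_ne h2 fun e => hj ⟨(c.1, c.2 + 1), by simp only; omega, ?_, ?_⟩
        · change c.1 + f (c.1 + 1) (c.2 + 2) = _
          omega
        · change c.2 + 1 + f (c.1 + 1) (c.2 + 2) = _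
          omega
    refine ⟨setEntry f c (entry f c + 1), hf.setEntry hc ?_ ?_ hout, ?_⟩
    · by_cases h : c.1 + c.2 + 2 < n
      · exact (hout h).1.trans (hf.le_bound _ _)
      · omega
    · exact (hf.innerMax_le hc).trans (Nat.le_succ _)
    · rw [hf.excitedSet_setEntry_succ hc]

/-- Every filling describes an excited diagram, by induction on the number of moves. -/
theorem IsFilling.isExcitedDiagram {n k : ℕ} (N : ℕ) : ∀ f, IsFilling n k f →
    ∑ c ∈ (staircase n).cells, entry f c = N →
    IsExcitedDiagram (staircase (n + 2 * k)) (staircase n) (excitedSet n f) := by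
  induction N with
  | zero =>
    intro f hf h
    rw [Finset.sum_eq_zero_iff] at h
    have : excitedSet n f = (staircase n).cells := by
      rw [excitedSet, Finset.image_congr (g := id), Finset.image_id]
      intro c hc
      simp [h c hc]
    rw [this]
    exact Relation.ReflTransGen.refl
  | succ N ih =>
    intro f hf h
    -- undo the last move of a square that is as close to the corner as possible
    obtain ⟨c, hc, hmin⟩ := Finset.exists_min_image
      ((staircase n).cells.filter fun c => 0 < entry f c) (fun c => c.1 + c.2) (by
        by_contra hne
        rw [Finset.not_nonempty_iff_eq_empty, Finset.filter_eq_empty_iff] at hne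
        rw [Finset.sum_eq_zero fun c hc => Nat.eq_zero_of_not_pos (hne hc)] at h
        omega)
    simp only [Finset.mem_filter, YoungDiagram.mem_cells, mem_staircase] at hc hmin
    obtain ⟨hc, hpos⟩ := hc
    have hzero : ∀ d : ℕ × ℕ, d.1 + d.2 < c.1 + c.2 → entry f d = 0 := by
      intro d hd
      by_contra hne
      have := hmin d ⟨by omega, by omega⟩
      omega
    have hin : innerMax f c = 0 := by
      rw [innerMax, Nat.max_eq_zero_iff]
      constructor
      · rcases Nat.eq_zero_or_pos c.1 with h0 | h0
        · rw [h0, hf.zero_left]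
        · have := hzero (c.1 - 1, c.2) (by simp only; omega)
          rwa [entry, Nat.sub_add_cancel h0] at this
      · rcases Nat.eq_zero_or_pos c.2 with h0 | h0
        · rw [h0, hf.zero_right]
        · have := hzero (c.1, c.2 - 1) (by simp only; omega)
          rwa [entry, Nat.sub_add_cancel h0] at this
    obtain ⟨v, hv⟩ : ∃ v, entry f c = v + 1 := ⟨entry f c - 1, by omega⟩
    have hvk : v + 1 ≤ k := hv ▸ hf.le_bound _ _
    have hg : IsFilling n k (setEntry f c v) := by
      refine hf.setEntry hc (by omega) (by omega) fun h => ?_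
      obtain ⟨h1, h2⟩ := hf.entry_le_succ h
      exact ⟨by omega, by omega⟩
    have hgf : setEntry (setEntry f c v) c (v + 1) = f := by
      funext i j
      simp only [setEntry]
      split_ifs with hij
      · rw [hij.1, hij.2, ← hv, entry]
      · rfl
    have hsum : ∑ d ∈ (staircase n).cells, entry (setEntry f c v) d = N := by
      have hc' : c ∈ (staircase n).cells := by
        rwa [YoungDiagram.mem_cells, mem_staircase]
      have hrest : ∑ d ∈ (staircase n).cells.erase c, entry (setEntry f c v) d =
          ∑ d ∈ (staircase n).cells.erase c, entry f d :=
        Finset.sum_congr rfl fun d hd => entry_setEntry_of_ne f (Finset.ne_of_mem_erase hd) v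
      rw [← Finset.add_sum_erase _ _ hc'] at h ⊢
      rw [entry_setEntry_self, hrest]
      omega
    refine Relation.ReflTransGen.tail (ih _ hg hsum) ?_
    have hself := entry_setEntry_self f c v
    have hfree : ∀ a b, (a, b) ∈ excitedSet n (setEntry f c v) →
        (a = c.1 + v + 1 ∨ a = c.1 + v) → (b = c.2 + v + 1 ∨ b = c.2 + v) →
        a = c.1 + v ∧ b = c.2 + v := by
      intro a b hab ha hb
      obtain ⟨d, hd, h1, h2⟩ := mem_excitedSet.mp hab
      by_cases hdc : d = c
      · subst hdc
        omega
      · rw [entry_setEntry_of_ne f hdc] at h1 h2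
        have hz := hzero d
        by_cases hle : c.1 ≤ d.1 ∧ c.2 ≤ d.2
        · have := hf.entry_mono hle.1 hle.2 hd
          have : ¬ (d.1 = c.1 ∧ d.2 = c.2) := fun h => hdc (Prod.ext h.1 h.2)
          omega
        · omega
    refine ⟨c.1 + v, c.2 + v, mem_excitedSet.mpr ⟨c, hc, by rw [hself], by rw [hself]⟩,
      fun h => ?_, fun h => ?_, fun h => ?_, ?_, ?_⟩
    · have := hfree _ _ h (by omega) (by omega); omega
    · have := hfree _ _ h (by omega) (by omega); omega
    · have := hfree _ _ h (by omega) (by omega); omega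
    · rw [mem_staircase]; omega
    · have := hg.excitedSet_setEntry_succ hc
      rwa [hself, hgf] at this

theorem isPleasantDiagram_iff {n k : ℕ} {P : Finset (ℕ × ℕ)} :
    IsPleasantDiagram (staircase (n + 2 * k)) (staircase n) P ↔
      ∃ f, IsFilling n k f ∧ P ⊆ (staircase (n + 2 * k)).cells \ excitedSet n f := by
  constructor
  · rintro ⟨D, hD, hP⟩
    obtain ⟨f, hf, rfl⟩ := hD.exists_filling
    exact ⟨f, hf, hP⟩
  · rintro ⟨f, hf, hP⟩
    exact ⟨_, hf.isExcitedDiagram _ f rfl, hP⟩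

namespace IsFilling

variable {n k : ℕ} {f : ℕ → ℕ → ℕ}

theorem card_excitedSet (hf : IsFilling n k f) : (excitedSet n f).card = (staircase n).card := by
  refine Finset.card_image_of_injOn fun c hc d hd h => ?_
  rw [Finset.mem_coe, YoungDiagram.mem_cells, mem_staircase] at hc hd
  rw [Prod.mk.injEq] at h
  exact hf.shift_injective hc hd h.1 h.2

theorem excitedSet_subset (hf : IsFilling n k f) :
    excitedSet n f ⊆ (staircase (n + 2 * k)).cells := by
  rintro ⟨a, b⟩ h
  obtain ⟨c, hc, rfl, rfl⟩ := mem_excitedSet.mp h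
  have : entry f c ≤ k := hf.le_bound _ _
  rw [YoungDiagram.mem_cells, mem_staircase]
  omega

/-- A square `d` above and weakly to the left of `c` moves at most as far as `innerMax f c`, the
point from which the jump of `c` is counted. -/
theorem entry_le_innerMax (hf : IsFilling n k f) {c d : ℕ × ℕ} (hc : c.1 + c.2 + 1 < n)
    (h1 : d.1 < c.1) (h2 : d.2 ≤ c.2) : entry f d ≤ innerMax f c := by
  have := hf.entry_mono (c := d) (d := (c.1 - 1, c.2)) (by simp only; omega) h2
    (by simp only; omega)
  refine this.trans (le_max_of_le_left ?_)
  rw [entry, Nat.sub_add_cancel (by omega)]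

theorem jumpCells_subset (hf : IsFilling n k f) :
    jumpCells n f ⊆ (staircase (n + 2 * k)).cells \ excitedSet n f := by
  rintro ⟨a, b⟩ h
  obtain ⟨c, hc, t, ht, hab⟩ := mem_jumpCells.mp h
  rw [Prod.mk.injEq] at hab
  obtain ⟨rfl, rfl⟩ := hab
  have : entry f c ≤ k := hf.le_bound _ _
  rw [Finset.mem_sdiff, YoungDiagram.mem_cells, mem_staircase, mem_excitedSet]
  refine ⟨by omega, ?_⟩
  rintro ⟨d, hd, h1, h2⟩
  rcases Nat.lt_or_ge d.1 c.1 with h | h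
  · have := hf.entry_le_innerMax hc h (by omega)
    omega
  · have := hf.entry_mono h (by omega) hd
    omega

theorem card_jumpCells (hf : IsFilling n k f) : (jumpCells n f).card = innerJumps n f := by
  rw [jumpCells, Finset.card_biUnion]
  · refine Finset.sum_congr rfl fun c _ => ?_
    rw [Finset.card_image_of_injective _ fun s t h => Nat.add_left_cancel (Prod.ext_iff.mp h).1,
      Nat.card_Ico, entry]
  · have key : ∀ c ∈ (staircase n).cells, ∀ d ∈ (staircase n).cells, c.1 < d.1 → Disjoint
        ((Finset.Ico (innerMax f c) (entry f c)).image fun t => (c.1 + t, c.2 + t))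
        ((Finset.Ico (innerMax f d) (entry f d)).image fun t => (d.1 + t, d.2 + t)) := by
      intro c hc d hd hcd
      rw [YoungDiagram.mem_cells, mem_staircase] at hc hd
      rw [Finset.disjoint_left]
      intro p hp hp'
      simp only [Finset.mem_image, Finset.mem_Ico] at hp hp'
      obtain ⟨s, hs, rfl⟩ := hp
      obtain ⟨t, ht, h⟩ := hp'
      rw [Prod.mk.injEq] at h
      have := hf.entry_le_innerMax hd hcd (by omega)
      omega
    intro c hc d hd hcd
    rcases lt_trichotomy c.1 d.1 with h | h | h
    · exact key c hc d hd h
    · rw [Function.onFun, Finset.disjoint_left]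
      intro p hp hp'
      simp only [Finset.mem_image, Finset.mem_Ico] at hp hp'
      obtain ⟨s, hs, rfl⟩ := hp
      obtain ⟨t, ht, h'⟩ := hp'
      rw [Prod.mk.injEq] at h'
      exact hcd (Prod.ext h (by omega))
    · exact (key d hd c hc h).symm

/-- Two different fillings cannot both be minimal for the same pleasant diagram: look at a cell
closest to the corner where they differ. -/
theorem eq_of_mem_Icc {g : ℕ → ℕ → ℕ} (hf : IsFilling n k f) (hg : IsFilling n k g)
    {P : Finset (ℕ × ℕ)}
    (hPf : P ∈ Finset.Icc (jumpCells n f) ((staircase (n + 2 * k)).cells \ excitedSet n f))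
    (hPg : P ∈ Finset.Icc (jumpCells n g) ((staircase (n + 2 * k)).cells \ excitedSet n g)) :
    f = g := by
  have step : ∀ {f g : ℕ → ℕ → ℕ}, P ∈ Finset.Icc (jumpCells n f)
      ((staircase (n + 2 * k)).cells \ excitedSet n f) → P ∈ Finset.Icc (jumpCells n g)
      ((staircase (n + 2 * k)).cells \ excitedSet n g) → IsFilling n k f →
      ∀ c : ℕ × ℕ, c.1 + c.2 + 1 < n → innerMax f c = innerMax g c →
      entry g c ≤ entry f c := by
    intro f g hPf hPg hf c hc hin
    rw [Finset.mem_Icc] at hPf hPg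
    by_contra! hlt
    have hmem : (c.1 + entry f c, c.2 + entry f c) ∈ jumpCells n g :=
      mem_jumpCells.mpr ⟨c, hc, entry f c, ⟨hin ▸ hf.innerMax_le hc, hlt⟩, rfl⟩
    have := hPf.2 (hPg.1 hmem)
    rw [Finset.mem_sdiff] at this
    exact this.2 (mem_excitedSet.mpr ⟨c, hc, rfl, rfl⟩)
  have key : ∀ m i j, i + j = m → f i j = g i j := by
    intro m
    induction m with
    | zero =>
      intro i j hij
      rw [show i = 0 by omega, hf.zero_left, hg.zero_left]
    | succ m ih =>
      intro i j hij
      rcases Nat.eq_zero_or_pos i with rfl | hi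
      · rw [hf.zero_left, hg.zero_left]
      rcases Nat.eq_zero_or_pos j with rfl | hj
      · rw [hf.zero_right, hg.zero_right]
      by_cases hn : n < i + j
      · rw [hf.zero_out i j hn, hg.zero_out i j hn]
      have hin : innerMax f (i - 1, j - 1) = innerMax g (i - 1, j - 1) := by
        simp only [innerMax, Nat.sub_add_cancel hi, Nat.sub_add_cancel hj]
        rw [ih (i - 1) j (by omega), ih i (j - 1) (by omega)]
      have h1 := step hPf hPg hf (i - 1, j - 1) (by simp only; omega) hin
      have h2 := step hPg hPf hg (i - 1, j - 1) (by simp only; omega) hin.symm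
      simp only [entry, Nat.sub_add_cancel hi, Nat.sub_add_cancel hj] at h1 h2
      omega
  funext i j
  exact key _ i j rfl

end IsFilling

/-- Every pleasant diagram avoids `excitedSet n f` for a filling `f` with the smallest sum of
entries. That it then contains `jumpCells n f` is the minimality: otherwise an entry could be
lowered. -/
theorem exists_mem_Icc_of_isPleasantDiagram {n k : ℕ} {P : Finset (ℕ × ℕ)}
    (hP : IsPleasantDiagram (staircase (n + 2 * k)) (staircase n) P) :
    ∃ f, IsFilling n k f ∧
      P ∈ Finset.Icc (jumpCells n f) ((staircase (n + 2 * k)).cells \ excitedSet n f) := by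
  classical
  obtain ⟨f₀, hf₀, hP₀⟩ := isPleasantDiagram_iff.mp hP
  obtain ⟨f, hf, hmin⟩ := Finset.exists_min_image ((fillings n k).filter fun f =>
    P ⊆ (staircase (n + 2 * k)).cells \ excitedSet n f)
    (fun f => ∑ c ∈ (staircase n).cells, entry f c)
    ⟨f₀, Finset.mem_filter.mpr ⟨mem_fillings.mpr hf₀, hP₀⟩⟩
  simp only [Finset.mem_filter, mem_fillings] at hf hmin
  obtain ⟨hf, hPf⟩ := hf
  refine ⟨f, hf, Finset.mem_Icc.mpr ⟨fun p hp => ?_, hPf⟩⟩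
  obtain ⟨c, hc, t, ht, rfl⟩ := mem_jumpCells.mp hp
  by_contra hnot
  have hk : entry f c ≤ k := hf.le_bound _ _
  have hg : IsFilling n k (setEntry f c t) := by
    refine hf.setEntry hc (by omega) ht.1 fun h => ?_
    obtain ⟨h1, h2⟩ := hf.entry_le_succ h
    exact ⟨by omega, by omega⟩
  have hPg : P ⊆ (staircase (n + 2 * k)).cells \ excitedSet n (setEntry f c t) := by
    rintro ⟨a, b⟩ hab
    have := Finset.mem_sdiff.mp (hPf hab)
    refine Finset.mem_sdiff.mpr ⟨this.1, fun h => ?_⟩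
    obtain ⟨d, hd, h1, h2⟩ := mem_excitedSet.mp h
    by_cases hdc : d = c
    · subst hdc
      rw [entry_setEntry_self] at h1 h2
      subst h1 h2
      exact hnot hab
    · rw [entry_setEntry_of_ne f hdc] at h1 h2
      exact this.2 (mem_excitedSet.mpr ⟨d, hd, h1, h2⟩)
  have hle := hmin _ ⟨hg, hPg⟩
  have hc' : c ∈ (staircase n).cells := by rwa [YoungDiagram.mem_cells, mem_staircase]
  have hrest : ∑ d ∈ (staircase n).cells.erase c, entry (setEntry f c t) d =
      ∑ d ∈ (staircase n).cells.erase c, entry f d :=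
    Finset.sum_congr rfl fun d hd => entry_setEntry_of_ne f (Finset.ne_of_mem_erase hd) t
  rw [← Finset.add_sum_erase _ _ hc', ← Finset.add_sum_erase _ _ hc', entry_setEntry_self,
    hrest] at hle
  omega

/-- The pleasant diagrams are the disjoint union of the intervals of sets between `jumpCells n f`
and the complement of `excitedSet n f`. -/
theorem numPleasant_eq_sum (n k : ℕ) :
    numPleasant (staircase (n + 2 * k)) (staircase n) = ∑ f ∈ fillings n k,
      2 ^ ((staircase (n + 2 * k)).card - (staircase n).card - innerJumps n f) := by
  classical
  have e : pleasantDiagrams (staircase (n + 2 * k)) (staircase n) =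
      (fillings n k).biUnion fun f =>
        Finset.Icc (jumpCells n f) ((staircase (n + 2 * k)).cells \ excitedSet n f) := by
    ext P
    rw [mem_pleasantDiagrams, Finset.mem_biUnion]
    constructor
    · intro hP
      obtain ⟨f, hf, h⟩ := exists_mem_Icc_of_isPleasantDiagram hP
      exact ⟨f, mem_fillings.mpr hf, h⟩
    · rintro ⟨f, hf, h⟩
      exact isPleasantDiagram_iff.mpr ⟨f, mem_fillings.mp hf, (Finset.mem_Icc.mp h).2⟩
  rw [numPleasant, e, Finset.card_biUnion]
  · refine Finset.sum_congr rfl fun f hf => ?_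
    rw [mem_fillings] at hf
    rw [Finset.card_Icc_finset hf.jumpCells_subset, hf.card_jumpCells,
      Finset.card_sdiff_of_subset hf.excitedSet_subset, hf.card_excitedSet]
  · intro f hf g hg hne
    rw [Finset.mem_coe, mem_fillings] at hf hg
    rw [Function.onFun, Finset.disjoint_left]
    exact fun P hPf hPg => hne (hf.eq_of_mem_Icc hg hPf hPg)

theorem IsFilling.innerJumps_le {n k : ℕ} {f : ℕ → ℕ → ℕ} (hf : IsFilling n k f) :
    innerJumps n f ≤ (staircase (n + 2 * k)).card - (staircase n).card := by
  have := Finset.card_le_card hf.jumpCells_subset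
  rwa [hf.card_jumpCells, Finset.card_sdiff_of_subset hf.excitedSet_subset,
    hf.card_excitedSet] at this

theorem two_mul_card_staircase (n : ℕ) : 2 * (staircase n).card + n = n * n := by
  cases n with
  | zero =>
    have : (staircase 0).cells = ∅ := by ext c; simp [mem_staircase]
    simp [this]
  | succ n =>
    have h := sum_staircase n fun _ => 1
    simp only [Finset.sum_const, Finset.Nat.card_antidiagonal, smul_eq_mul, mul_one] at h
    rw [YoungDiagram.card, h]
    clear h
    induction n with
    | zero => simp
    | succ n ih =>
      rw [Finset.sum_range_succ]
      nlinarith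

/-- The number of pleasant diagrams of `δ_{n+2k} / δ_n` as a power of `2` times a sum of powers of
`1 / 2`. -/
theorem numPleasant_eq_mul_sum (n k : ℕ) :
    (numPleasant (staircase (n + 2 * k)) (staircase n) : ℚ) * 2 ^ k =
      2 ^ (2 * n * k + 2 * k ^ 2) * ∑ f ∈ fillings n k, (1 / 2) ^ innerJumps n f := by
  have e : (staircase (n + 2 * k)).card - (staircase n).card + k = 2 * n * k + 2 * k ^ 2 := by
    have h1 := two_mul_card_staircase n
    have h2 := two_mul_card_staircase (n + 2 * k)
    have : (n + 2 * k) * (n + 2 * k) = n * n + 4 * (n * k) + 4 * k ^ 2 := by ring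
    have : 2 * n * k = 2 * (n * k) := by ring
    have : k ≤ k ^ 2 := Nat.le_self_pow two_ne_zero k
    omega
  rw [← e, pow_add, numPleasant_eq_sum]
  push_cast
  rw [mul_right_comm, Finset.mul_sum]
  congr 1
  refine Finset.sum_congr rfl fun f hf => ?_
  rw [pow_sub₀ _ two_ne_zero (mem_fillings.mp hf).innerJumps_le, one_div, inv_pow]

/-! ### Nested Dyck paths as fillings -/

namespace DyckPath

variable {n : ℕ}

theorem walk (D : DyckPath n) (m : ℕ) : ∀ x : ℤ, -(n : ℤ) ≤ x → x + m ≤ n →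
    (D.height (x + m) : ℤ) ≤ D.height x + m ∧ (D.height x : ℤ) ≤ D.height (x + m) + m ∧
      ((D.height (x + m) : ℤ) + D.height x + m) % 2 = 0 := by
  induction m with
  | zero => intro x _ _; simp; omega
  | succ m ih =>
    intro x hx hm
    obtain ⟨h1, h2, h3⟩ := ih x hx (by omega)
    have := D.step (x + m) (by omega) (by omega)
    push_cast
    rw [← add_assoc]
    omega

theorem height_parity (D : DyckPath n) {x : ℤ} (h1 : -(n : ℤ) ≤ x) (h2 : x ≤ n) :
    ((D.height x : ℤ) + x + n) % 2 = 0 := by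
  have h := (D.walk (x + n).toNat (-(n : ℤ)) le_rfl (by omega)).2.2
  rw [D.height_eq_zero (-(n : ℤ)) (by simp), show -(n : ℤ) + ((x + n).toNat : ℤ) = x by omega] at h
  omega

theorem height_le (D : DyckPath n) {x : ℤ} (h1 : -(n : ℤ) ≤ x) (h2 : x ≤ n) :
    (D.height x : ℤ) ≤ n + x ∧ (D.height x : ℤ) ≤ n - x := by
  have h := (D.walk (x + n).toNat (-(n : ℤ)) le_rfl (by omega)).1
  have h' := (D.walk (n - x).toNat x h1 (by omega)).2.1
  rw [D.height_eq_zero (-(n : ℤ)) (by simp), show -(n : ℤ) + ((x + n).toNat : ℤ) = x by omega] at h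
  rw [show x + ((n - x).toNat : ℤ) = n by omega, D.height_eq_zero (n : ℤ) (by simp)] at h'
  omega

theorem step_right (D : DyckPath n) {x : ℤ} (h1 : -(n : ℤ) ≤ x) (h2 : x < n) :
    D.height (x + 1) = D.height x + 1 ∨ D.height x = D.height (x + 1) + 1 :=
  D.step x h1 h2

theorem step_left (D : DyckPath n) {x : ℤ} (h1 : -(n : ℤ) < x) (h2 : x ≤ n) :
    D.height x = D.height (x - 1) + 1 ∨ D.height (x - 1) = D.height x + 1 := by
  have := D.step (x - 1) (by omega) (by omega)
  rwa [sub_add_cancel] at this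

end DyckPath

/-- The paths of a family lie strictly above one another, in the order of their indices. -/
def IsNested {n k : ℕ} (D : (l : Fin k) → DyckPath (n + 2 * (l : ℕ))) : Prop :=
  ∀ i j : Fin k, i < j → (D i).StrictlyBelow (D j)

theorem mem_nonIntersectingDyckPaths {n k : ℕ} {D : (l : Fin k) → DyckPath (n + 2 * (l : ℕ))} :
    D ∈ nonIntersectingDyckPaths n k ↔ IsNested D := by
  simp [nonIntersectingDyckPaths, IsNested]

/-- The indices of the paths that pass above the cell `(i, j)` of the staircase. The rows and
columns are numbered from `1`, and the top of the cell is placed at `(j - i, n + 2 - i - j)`; the part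
of the `l`-th path over `[-n, n]` is shifted down by `2 * l` first. -/
def pathsAbove {n k : ℕ} (D : (l : Fin k) → DyckPath (n + 2 * (l : ℕ))) (i j : ℕ) :
    Finset (Fin k) :=
  {l | 2 * (l : ℤ) + n + 2 ≤ (D l).height (j - i) + i + j}

/-- The filling of the staircase that counts in each cell the paths above it. -/
def pathFilling {n k : ℕ} (D : (l : Fin k) → DyckPath (n + 2 * (l : ℕ))) (i j : ℕ) : ℕ :=
  if 1 ≤ i ∧ 1 ≤ j ∧ i + j ≤ n then (pathsAbove D i j).card else 0

theorem mem_pathsAbove {n k : ℕ} {D : (l : Fin k) → DyckPath (n + 2 * (l : ℕ))} {i j : ℕ}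
    {l : Fin k} : l ∈ pathsAbove D i j ↔
      2 * (l : ℤ) + n + 2 ≤ (D l).height (j - i) + i + j := by
  simp [pathsAbove]

theorem pathsAbove_subset_left {n k : ℕ} (D : (l : Fin k) → DyckPath (n + 2 * (l : ℕ))) {i j : ℕ}
    (hj : 1 ≤ j) (h : i + 1 + j ≤ n + 1) : pathsAbove D i j ⊆ pathsAbove D (i + 1) j := by
  intro l hl
  rw [mem_pathsAbove] at *
  have := (D l).step_left (x := j - i) (by push_cast; omega) (by push_cast; omega)
  push_cast
  rw [show (j : ℤ) - (i + 1) = j - i - 1 by ring]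
  omega

theorem pathsAbove_subset_right {n k : ℕ} (D : (l : Fin k) → DyckPath (n + 2 * (l : ℕ))) {i j : ℕ}
    (hi : 1 ≤ i) (h : i + (j + 1) ≤ n + 1) : pathsAbove D i j ⊆ pathsAbove D i (j + 1) := by
  intro l hl
  rw [mem_pathsAbove] at *
  have := (D l).step_right (x := j - i) (by push_cast; omega) (by push_cast; omega)
  push_cast
  rw [show (j : ℤ) + 1 - i = j - i + 1 by ring]
  omega

theorem isFilling_pathFilling {n k : ℕ} (D : (l : Fin k) → DyckPath (n + 2 * (l : ℕ))) :
    IsFilling n k (pathFilling D) where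
  zero_left j := if_neg (by omega)
  zero_right i := if_neg (by omega)
  zero_out i j h := if_neg (by omega)
  mono_left i j h := by
    by_cases hij : 1 ≤ i ∧ 1 ≤ j
    · rw [pathFilling, pathFilling, if_pos (by omega), if_pos (by omega)]
      exact Finset.card_le_card (pathsAbove_subset_left D hij.2 (by omega))
    · rw [pathFilling, if_neg (by omega)]
      exact Nat.zero_le _
  mono_right i j h := by
    by_cases hij : 1 ≤ i ∧ 1 ≤ j
    · rw [pathFilling, pathFilling, if_pos (by omega), if_pos (by omega)]
      exact Finset.card_le_card (pathsAbove_subset_right D hij.1 (by omega))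
    · rw [pathFilling, if_neg (by omega)]
      exact Nat.zero_le _
  le_bound i j := by
    rw [pathFilling]
    split_ifs
    · exact (Finset.card_le_univ _).trans (Fintype.card_fin k).le
    · exact Nat.zero_le k

/-- An upper set of `Fin k` is determined by its cardinality. -/
theorem mem_iff_le_add_card {k : ℕ} {S : Finset (Fin k)} (hS : ∀ l m, l ≤ m → l ∈ S → m ∈ S)
    (l : Fin k) : l ∈ S ↔ k ≤ l + S.card := by
  constructor
  · intro hl
    have := Finset.card_le_card (show Finset.Ici l ⊆ S from fun m hm =>
      hS l m (Finset.mem_Ici.mp hm) hl)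
    rw [Fin.card_Ici] at this
    omega
  · intro h
    by_contra hl
    have := Finset.card_le_card (show S ⊆ Finset.Ioi l from fun m hm => by
      rw [Finset.mem_Ioi]
      by_contra hml
      exact hl (hS m l (not_lt.mp hml) hm))
    rw [Fin.card_Ioi] at this
    omega

namespace IsNested

variable {n k : ℕ} {D : (l : Fin k) → DyckPath (n + 2 * (l : ℕ))}

/-- By parity, consecutive paths over `[-n, n]` have distance at least `2`. -/
theorem height_add_le (hD : IsNested D) {x : ℤ} (h1 : -(n : ℤ) ≤ x) (h2 : x ≤ n) (d : ℕ) :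
    ∀ l m : Fin k, (m : ℕ) = l + d → (D l).height x + 2 * d ≤ (D m).height x := by
  induction d with
  | zero =>
    intro l m h
    obtain rfl : l = m := Fin.ext (by omega)
    simp
  | succ d ih =>
    intro l m h
    have hm := m.2
    have e := ih l ⟨l + d, by omega⟩ rfl
    have hlt := hD ⟨l + d, by omega⟩ m (Fin.lt_def.mpr (by simp only; omega)) x
      (by push_cast; omega) (by push_cast; omega)
    have p1 := (D m).height_parity (x := x) (by push_cast; omega) (by push_cast; omega)
    have p2 := (D ⟨l + d, by omega⟩).height_parity (x := x) (by push_cast; omega)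
      (by push_cast; omega)
    push_cast at p1 p2
    omega

theorem two_mul_le_height (hD : IsNested D) {x : ℤ} (h1 : -(n : ℤ) ≤ x) (h2 : x ≤ n)
    (l : Fin k) : 2 * (l : ℕ) ≤ (D l).height x := by
  have := hD.height_add_le h1 h2 l ⟨0, by have := l.2; omega⟩ l (by simp)
  omega

theorem height_of_le (hD : IsNested D) (l : Fin k) {x : ℤ} (h : (n : ℤ) ≤ x)
    (h' : x ≤ n + 2 * l) : ((D l).height x : ℤ) = n + 2 * l - x := by
  have h1 := hD.two_mul_le_height (x := n) (by omega) le_rfl l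
  have h2 := ((D l).walk (x - n).toNat n (by push_cast; omega) (by push_cast; omega)).2.1
  have h3 := ((D l).height_le (x := x) (by push_cast; omega) (by push_cast; omega)).2
  rw [show (n : ℤ) + ((x - n).toNat : ℤ) = x by omega] at h2
  push_cast at h3
  omega

theorem height_of_le_neg (hD : IsNested D) (l : Fin k) {x : ℤ} (h : x ≤ -(n : ℤ))
    (h' : -(n + 2 * l : ℤ) ≤ x) : ((D l).height x : ℤ) = n + 2 * l + x := by
  have h1 := hD.two_mul_le_height (x := -(n : ℤ)) le_rfl (by omega) l
  have h2 := ((D l).walk (-n - x).toNat x (by push_cast; omega) (by push_cast; omega)).1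
  have h3 := ((D l).height_le (x := x) (by push_cast; omega) (by push_cast; omega)).1
  rw [show x + ((-n - x).toNat : ℤ) = -n by omega] at h2
  push_cast at h3
  omega

theorem mem_pathsAbove_of_le (hD : IsNested D) {i j : ℕ} (h : i ≤ n + j) (h' : j ≤ n + i)
    (l m : Fin k) (hlm : l ≤ m) (hl : l ∈ pathsAbove D i j) : m ∈ pathsAbove D i j := by
  rw [mem_pathsAbove] at *
  have := hD.height_add_le (x := j - i) (by omega) (by omega) (m - l) l m
    (by rw [Fin.le_def] at hlm; omega)
  rw [Fin.le_def] at hlm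
  omega

theorem mem_pathsAbove_iff (hD : IsNested D) {i j : ℕ} (hi : 1 ≤ i) (hj : 1 ≤ j) (h : i + j ≤ n)
    (l : Fin k) : l ∈ pathsAbove D i j ↔ k ≤ l + pathFilling D i j := by
  rw [mem_iff_le_add_card (hD.mem_pathsAbove_of_le (by omega) (by omega)), pathFilling,
    if_pos ⟨hi, hj, h⟩]

theorem height_le_of_pathFilling_eq {D' : (l : Fin k) → DyckPath (n + 2 * (l : ℕ))}
    (hD : IsNested D) (hD' : IsNested D') (h : pathFilling D = pathFilling D') (l : Fin k) {x : ℤ}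
    (h1 : -(n : ℤ) ≤ x) (h2 : x ≤ n) : (D' l).height x ≤ (D l).height x := by
  by_contra! hlt
  have p := (D l).height_parity (x := x) (by push_cast; omega) (by push_cast; omega)
  have p' := (D' l).height_parity (x := x) (by push_cast; omega) (by push_cast; omega)
  have b := (D' l).height_le (x := x) (by push_cast; omega) (by push_cast; omega)
  have c := hD.two_mul_le_height h1 h2 l
  push_cast at p p' b
  -- the cell right below the upper one of the two paths
  obtain ⟨i, hi⟩ : ∃ i : ℕ, 2 * (i : ℤ) = n - x - (D' l).height x + 2 * l + 2 :=
    ⟨((n - x - (D' l).height x + 2 * l + 2) / 2).toNat, by omega⟩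
  obtain ⟨j, hj⟩ : ∃ j : ℕ, (j : ℤ) = x + i := ⟨(x + i).toNat, by omega⟩
  have hx : (j : ℤ) - i = x := by omega
  have m' : l ∈ pathsAbove D' i j := by
    rw [mem_pathsAbove, hx]
    omega
  rw [hD'.mem_pathsAbove_iff (by omega) (by omega) (by omega), ← h,
    ← hD.mem_pathsAbove_iff (by omega) (by omega) (by omega), mem_pathsAbove, hx] at m'
  omega

theorem pathFilling_injective {D' : (l : Fin k) → DyckPath (n + 2 * (l : ℕ))}
    (hD : IsNested D) (hD' : IsNested D') (h : pathFilling D = pathFilling D') : D = D' := by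
  funext l
  ext x
  rcases lt_or_ge (x : ℤ) (-(n + 2 * (l : ℕ) : ℤ)) with h1 | h1
  · rw [(D l).height_eq_zero x (by rw [abs_of_neg (by omega)]; push_cast; omega),
      (D' l).height_eq_zero x (by rw [abs_of_neg (by omega)]; push_cast; omega)]
  rcases lt_or_ge (n + 2 * (l : ℕ) : ℤ) x with h2 | h2
  · rw [(D l).height_eq_zero x (by rw [abs_of_pos (by omega)]; push_cast; omega),
      (D' l).height_eq_zero x (by rw [abs_of_pos (by omega)]; push_cast; omega)]
  rcases le_total x (-(n : ℤ)) with h3 | h3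
  · have e1 := hD.height_of_le_neg l h3 h1
    have e2 := hD'.height_of_le_neg l h3 h1
    omega
  rcases le_total (n : ℤ) x with h4 | h4
  · have e1 := hD.height_of_le l h4 h2
    have e2 := hD'.height_of_le l h4 h2
    omega
  exact le_antisymm (height_le_of_pathFilling_eq hD' hD h.symm l h3 h4)
    (height_le_of_pathFilling_eq hD hD' h l h3 h4)

end IsNested

/-- The Dyck path `E` shifted up by `2 * l`, with `2 * l` up steps added in front of it and `2 * l`
down steps added behind it. -/
def DyckPath.raise {n : ℕ} (E : DyckPath n) (l : ℕ) : DyckPath (n + 2 * l) where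
  height x := if |x| ≤ n then 2 * l + E.height x else (n + 2 * l - |x|).toNat
  height_eq_zero x hx := by
    push_cast at hx
    split_ifs with h
    · have := E.height_eq_zero x (by omega)
      omega
    · omega
  step x h1 h2 := by
    push_cast at h1 h2
    by_cases h : -(n : ℤ) ≤ x ∧ x < n
    · rw [if_pos (abs_le.mpr ⟨h.1, h.2.le⟩), if_pos (abs_le.mpr ⟨by omega, by omega⟩)]
      have := E.step x h.1 h.2
      omega
    · have straight : ∀ y : ℤ, (n : ℤ) ≤ |y| →
          (if |y| ≤ n then 2 * l + E.height y else (n + 2 * l - |y|).toNat) =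
            (n + 2 * l - |y|).toNat := by
        intro y hy
        split_ifs with h
        · have := E.height_eq_zero y hy
          omega
        · rfl
      have a1 : (n : ℤ) ≤ |x| := by rcases abs_cases x with h | h <;> omega
      have a2 : (n : ℤ) ≤ |x + 1| := by rcases abs_cases (x + 1) with h | h <;> omega
      rw [straight x a1, straight (x + 1) a2]
      rcases abs_cases x with h | h <;> rcases abs_cases (x + 1) with h' | h' <;> omega

theorem DyckPath.height_raise {n : ℕ} (E : DyckPath n) (l : ℕ) {x : ℤ} (hx : |x| ≤ n) :
    (E.raise l).height x = 2 * l + E.height x := if_pos hx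

theorem isNested_raise {n k : ℕ} (E : Fin k → DyckPath n)
    (hE : ∀ l m, l < m → ∀ x, (E l).height x ≤ (E m).height x) :
    IsNested fun l : Fin k => (E l).raise l := by
  intro l m hlm x h1 h2
  have hE' := hE l m hlm x
  rw [Fin.lt_def] at hlm
  push_cast at h1 h2
  change (if |x| ≤ n then _ else _) < (if |x| ≤ n then _ else _)
  split_ifs with h
  · omega
  · have : |x| ≤ n + 2 * l := abs_le.mpr ⟨by omega, by omega⟩
    omega

/-- The point `(x, y)` is on or below the `l`-th path belonging to the filling `f`, once that path
is shifted down by `2 * l`: the point has the right parity, lies in the triangle under the highest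
path, and the cell that raises a path at `x` from `y - 2` to `y` carries an entry of at least
`k - l`. At the heights `0` and `1` there is no cell and no condition. -/
def Reaches (n k : ℕ) (f : ℕ → ℕ → ℕ) (l : ℕ) (x : ℤ) (y : ℕ) : Prop :=
  (x + n + y) % 2 = 0 ∧ y + |x| ≤ n ∧
    (y ≤ 1 ∨ k ≤ l + f ((n + 2 - y - x) / 2 : ℤ).toNat ((n + 2 - y + x) / 2 : ℤ).toNat)

open Classical in
/-- The height at `x` of the `l`-th path belonging to the filling `f`, shifted down by `2 * l`. -/
noncomputable def reachedHeight (n k : ℕ) (f : ℕ → ℕ → ℕ) (l : ℕ) (x : ℤ) : ℕ :=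
  Nat.findGreatest (Reaches n k f l x) n

section Reaches

variable {n k : ℕ} {f : ℕ → ℕ → ℕ} {l : ℕ} {x : ℤ}

theorem reaches_reachedHeight (hx : |x| ≤ n) : Reaches n k f l x (reachedHeight n k f l x) := by
  classical
  refine Nat.findGreatest_spec (m := ((x + n) % 2).toNat) ?_ ⟨?_, ?_, Or.inl ?_⟩
  all_goals rcases abs_cases x with h | h <;> omega

theorem Reaches.le {y : ℕ} (h : Reaches n k f l x y) : y ≤ reachedHeight n k f l x := by
  classical
  refine Nat.le_findGreatest ?_ h
  have := abs_nonneg x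
  have := h.2.1
  omega

theorem Reaches.of_le (hf : IsFilling n k f) {y y' : ℕ} (h : Reaches n k f l x y) (hy : y' ≤ y)
    (hp : (x + n + y') % 2 = 0) : Reaches n k f l x y' := by
  obtain ⟨h1, h2, h3⟩ := h
  refine ⟨hp, by omega, ?_⟩
  by_cases hy' : y' ≤ 1
  · exact Or.inl hy'
  · refine Or.inr ?_
    rcases h3 with h3 | h3
    · omega
    · refine h3.trans (Nat.add_le_add_left (hf.mono ?_ ?_ ?_) l)
      all_goals rcases abs_cases x with h | h <;> omega

theorem Reaches.succ (hf : IsFilling n k f) {y : ℕ} (h : Reaches n k f l x (y + 1))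
    {x' : ℤ} (hx' : x' = x + 1 ∨ x' = x - 1) : Reaches n k f l x' y := by
  obtain ⟨h1, h2, h3⟩ := h
  refine ⟨by omega, by rcases abs_cases x with h | h <;> rcases abs_cases x' with h' | h' <;> omega,
    ?_⟩
  by_cases hy' : y ≤ 1
  · exact Or.inl hy'
  · refine Or.inr ?_
    rcases h3 with h3 | h3
    · omega
    · refine h3.trans (Nat.add_le_add_left (hf.mono ?_ ?_ ?_) l)
      all_goals rcases abs_cases x with h | h <;> omega

theorem reachedHeight_step (hf : IsFilling n k f) {x' : ℤ} (hx : |x| ≤ n) (hx' : |x'| ≤ n)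
    (hxx' : x' = x + 1) : reachedHeight n k f l x' = reachedHeight n k f l x + 1 ∨
      reachedHeight n k f l x = reachedHeight n k f l x' + 1 := by
  have r := reaches_reachedHeight (k := k) (f := f) (l := l) hx
  have r' := reaches_reachedHeight (k := k) (f := f) (l := l) hx'
  have p := r.1
  have p' := r'.1
  have b : reachedHeight n k f l x ≤ reachedHeight n k f l x' + 1 := by
    rcases h : reachedHeight n k f l x with _ | y
    · omega
    · rw [h] at r
      have := (r.succ hf (Or.inl hxx')).le
      omega
  have b' : reachedHeight n k f l x' ≤ reachedHeight n k f l x + 1 := by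
    rcases h : reachedHeight n k f l x' with _ | y
    · omega
    · rw [h] at r'
      have := (r'.succ hf (x' := x) (Or.inr (by omega))).le
      omega
  omega

theorem reachedHeight_mono {m : ℕ} (hlm : l ≤ m) (hx : |x| ≤ n) :
    reachedHeight n k f l x ≤ reachedHeight n k f m x := by
  obtain ⟨h1, h2, h3⟩ := reaches_reachedHeight (k := k) (f := f) (l := l) hx
  exact Reaches.le ⟨h1, h2, h3.imp_right fun h => h.trans (by omega)⟩

theorem reachedHeight_of_abs_eq (hx : |x| = n) : reachedHeight n k f l x = 0 := by
  have := (reaches_reachedHeight (k := k) (f := f) (l := l) hx.le).2.1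
  omega

end Reaches

/-- The path belonging to the `l`-th level of the filling `f`, shifted down by `2 * l`. -/
noncomputable def levelPath {n k : ℕ} {f : ℕ → ℕ → ℕ} (hf : IsFilling n k f) (l : ℕ) :
    DyckPath n where
  height x := if |x| ≤ n then reachedHeight n k f l x else 0
  height_eq_zero x hx := by
    split_ifs with h
    · exact reachedHeight_of_abs_eq (le_antisymm h hx)
    · rfl
  step x h1 h2 := by
    have a1 : |x| ≤ n := abs_le.mpr ⟨h1, h2.le⟩
    have a2 : |x + 1| ≤ n := abs_le.mpr ⟨by omega, by omega⟩
    rw [if_pos a1, if_pos a2]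
    exact reachedHeight_step hf a1 a2 rfl

/-- The `l`-th path belonging to the filling `f`. -/
noncomputable def fillingPath {n k : ℕ} {f : ℕ → ℕ → ℕ} (hf : IsFilling n k f) (l : ℕ) :
    DyckPath (n + 2 * l) := (levelPath hf l).raise l

theorem isNested_fillingPath {n k : ℕ} {f : ℕ → ℕ → ℕ} (hf : IsFilling n k f) :
    IsNested fun l : Fin k => fillingPath hf l := by
  refine isNested_raise (fun l : Fin k => levelPath hf l) fun l m hlm x => ?_
  change (if |x| ≤ n then _ else _) ≤ (if |x| ≤ n then _ else _)
  split_ifs with h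
  · exact reachedHeight_mono hlm.le h
  · exact le_rfl

theorem mem_pathsAbove_fillingPath {n k : ℕ} {f : ℕ → ℕ → ℕ} (hf : IsFilling n k f) {i j : ℕ}
    (hi : 1 ≤ i) (hj : 1 ≤ j) (h : i + j ≤ n) (l : Fin k) :
    l ∈ pathsAbove (fun l : Fin k => fillingPath hf l) i j ↔ k ≤ l + f i j := by
  rw [mem_pathsAbove]
  have hx : |(j : ℤ) - i| ≤ n := abs_le.mpr ⟨by omega, by omega⟩
  have hx' : |(j : ℤ) - i| + 2 ≤ i + j := by rcases abs_cases ((j : ℤ) - i) with h | h <;> omega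
  rw [fillingPath, DyckPath.height_raise _ _ hx]
  change _ ≤ ((2 * (l : ℕ) + if |(j : ℤ) - i| ≤ n then _ else _ : ℕ) : ℤ) + i + j ↔ _
  rw [if_pos hx]
  obtain ⟨y, hy⟩ : ∃ y : ℕ, y + i + j = n + 2 := ⟨n + 2 - i - j, by omega⟩
  have e1 : ((n + 2 - y - (j - i)) / 2 : ℤ).toNat = i := by omega
  have e2 : ((n + 2 - y + (j - i)) / 2 : ℤ).toNat = j := by omega
  have key : Reaches n k f l (j - i) y ↔ k ≤ l + f i j := by
    rw [Reaches, e1, e2]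
    constructor
    · rintro ⟨-, -, h | h⟩
      · omega
      · exact h
    · exact fun h => ⟨by omega, by omega, Or.inr h⟩
  rw [← key]
  constructor
  · intro hle
    exact (reaches_reachedHeight hx).of_le hf (by push_cast at hle; omega) (by omega)
  · intro hr
    have := hr.le
    push_cast
    omega

theorem pathFilling_fillingPath {n k : ℕ} {f : ℕ → ℕ → ℕ} (hf : IsFilling n k f) :
    pathFilling (fun l : Fin k => fillingPath hf l) = f := by
  funext i j
  by_cases hij : 1 ≤ i ∧ 1 ≤ j ∧ i + j ≤ n
  · have e1 := mem_pathsAbove_fillingPath hf hij.1 hij.2.1 hij.2.2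
    have e2 := (isNested_fillingPath hf).mem_pathsAbove_iff hij.1 hij.2.1 hij.2.2
    have b1 := hf.le_bound i j
    have b2 := (isFilling_pathFilling (fun l : Fin k => fillingPath hf l)).le_bound i j
    generalize pathFilling (fun l : Fin k => fillingPath hf l) i j = v at *
    refine le_antisymm ?_ ?_
    · rcases Nat.eq_zero_or_pos v with h0 | h0
      · omega
      · have := (e1 ⟨k - v, by omega⟩).mp ((e2 ⟨k - v, by omega⟩).mpr (by simp only; omega))
        simp only at this
        omega
    · rcases Nat.eq_zero_or_pos (f i j) with h0 | h0
      · omega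
      · have := (e2 ⟨k - f i j, by omega⟩).mp
          ((e1 ⟨k - f i j, by omega⟩).mpr (by simp only; omega))
        simp only at this
        omega
  · rw [pathFilling, if_neg hij]
    by_cases hi : i = 0
    · rw [hi, hf.zero_left]
    by_cases hj : j = 0
    · rw [hj, hf.zero_right]
    rw [hf.zero_out i j (by omega)]

/-- Counting the paths above each cell is a bijection from nested families of Dyck paths to
fillings. -/
theorem sum_nonIntersectingDyckPaths {M : Type*} [AddCommMonoid M] (n k : ℕ)
    (F : (ℕ → ℕ → ℕ) → M) :
    ∑ D ∈ nonIntersectingDyckPaths n k, F (pathFilling D) = ∑ f ∈ fillings n k, F f := by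
  refine Finset.sum_nbij pathFilling ?_ ?_ ?_ fun _ _ => rfl
  · exact fun D _ => mem_fillings.mpr (isFilling_pathFilling D)
  · intro D hD D' hD' h
    rw [Finset.mem_coe, mem_nonIntersectingDyckPaths] at hD hD'
    exact hD.pathFilling_injective hD' h
  · intro f hf
    rw [Finset.mem_coe, mem_fillings] at hf
    exact ⟨_, Finset.mem_coe.mpr (mem_nonIntersectingDyckPaths.mpr (isNested_fillingPath hf)),
      pathFilling_fillingPath hf⟩

/-! ### Valleys and down steps of nested Dyck paths -/

/-- The number of down steps over `[-n, n]` that start an even number of steps after `-n`. -/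
def evenDowns (n : ℕ) {m : ℕ} (D : DyckPath m) : ℕ :=
  ((Finset.range n).filter fun t : ℕ =>
    D.height (-(n : ℤ) + 2 * t + 1) < D.height (-(n : ℤ) + 2 * t)).card

theorem sum_card_filter_comm {α β : Type*} (s : Finset α) (t : Finset β) (r : α → β → Prop)
    [∀ a b, Decidable (r a b)] :
    ∑ a ∈ s, (t.filter fun b => r a b).card = ∑ b ∈ t, (s.filter fun a => r a b).card :=
  Finset.sum_card_bipartiteAbove_eq_sum_card_bipartiteBelow r

namespace IsNested

variable {n k : ℕ} {D : (l : Fin k) → DyckPath (n + 2 * (l : ℕ))}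

theorem extendBy_pathFilling (hD : IsNested D) {i j : ℕ} (hi : 1 ≤ i) (hj : 1 ≤ j)
    (h : i + j ≤ n + 1) : extendBy n k (pathFilling D) i j = (pathsAbove D i j).card := by
  rw [extendBy]
  split_ifs with hn
  · -- beyond the staircase, every path is above
    rw [show pathsAbove D i j = Finset.univ from Finset.eq_univ_of_forall fun l => ?_,
      Finset.card_univ, Fintype.card_fin]
    have h1 := hD.two_mul_le_height (x := j - i) (by omega) (by omega) l
    have h2 := (D l).height_parity (x := j - i) (by push_cast; omega) (by push_cast; omega)
    rw [mem_pathsAbove]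
    push_cast at h2
    omega
  · rw [pathFilling, if_pos ⟨hi, hj, by omega⟩]

theorem min_card_pathsAbove_sub (hD : IsNested D) {c : ℕ × ℕ} (hc : c.1 + c.2 + 1 < n) :
    min (pathsAbove D (c.1 + 2) (c.2 + 1)).card (pathsAbove D (c.1 + 1) (c.2 + 2)).card -
      (pathsAbove D (c.1 + 1) (c.2 + 1)).card =
    (Finset.univ.filter fun l : Fin k => (D l).height (c.2 - c.1) + c.1 + c.2 + 2 = n + 2 * l ∧
      (D l).height (c.2 - c.1) < (D l).height (c.2 - c.1 - 1) ∧
      (D l).height (c.2 - c.1) < (D l).height (c.2 - c.1 + 1)).card := by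
  have s1 := pathsAbove_subset_left D (i := c.1 + 1) (j := c.2 + 1) (by omega) (by omega)
  have s2 := pathsAbove_subset_right D (i := c.1 + 1) (j := c.2 + 1) (by omega) (by omega)
  have hmin : min (pathsAbove D (c.1 + 2) (c.2 + 1)).card (pathsAbove D (c.1 + 1) (c.2 + 2)).card =
      (pathsAbove D (c.1 + 2) (c.2 + 1) ∩ pathsAbove D (c.1 + 1) (c.2 + 2)).card := by
    have u1 := mem_iff_le_add_card (hD.mem_pathsAbove_of_le (i := c.1 + 2) (j := c.2 + 1)
      (by omega) (by omega))
    have u2 := mem_iff_le_add_card (hD.mem_pathsAbove_of_le (i := c.1 + 1) (j := c.2 + 2)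
      (by omega) (by omega))
    rcases le_total (pathsAbove D (c.1 + 2) (c.2 + 1)).card
      (pathsAbove D (c.1 + 1) (c.2 + 2)).card with h | h
    · rw [min_eq_left h, Finset.inter_eq_left.mpr fun l hl => (u2 l).mpr ?_]
      exact ((u1 l).mp hl).trans (Nat.add_le_add_left h _)
    · rw [min_eq_right h, Finset.inter_eq_right.mpr fun l hl => (u1 l).mpr ?_]
      exact ((u2 l).mp hl).trans (Nat.add_le_add_left h _)
  rw [hmin, ← Finset.card_sdiff_of_subset (Finset.subset_inter s1 s2)]
  congr 1
  ext l
  have p := (D l).height_parity (x := c.2 - c.1) (by push_cast; omega) (by push_cast; omega)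
  have t1 := (D l).step_left (x := c.2 - c.1) (by push_cast; omega) (by push_cast; omega)
  have t2 := (D l).step_right (x := c.2 - c.1) (by push_cast; omega) (by push_cast; omega)
  simp only [Finset.mem_sdiff, Finset.mem_inter, mem_pathsAbove, Finset.mem_filter,
    Finset.mem_univ, true_and]
  push_cast at p ⊢
  rw [show (c.2 : ℤ) + 1 - (c.1 + 1 + 1) = c.2 - c.1 - 1 by ring,
    show (c.2 : ℤ) + 1 + 1 - (c.1 + 1) = c.2 - c.1 + 1 by ring,
    show (c.2 : ℤ) + 1 - (c.1 + 1) = c.2 - c.1 by ring]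
  omega

theorem card_valleys (hD : IsNested D) (l : Fin k) :
    ((staircase n).cells.filter fun c : ℕ × ℕ =>
      (D l).height (c.2 - c.1) + c.1 + c.2 + 2 = n + 2 * l ∧
      (D l).height (c.2 - c.1) < (D l).height (c.2 - c.1 - 1) ∧
      (D l).height (c.2 - c.1) < (D l).height (c.2 - c.1 + 1)).card = (D l).valleys.card := by
  refine Finset.card_bij (fun c _ => (c.2 : ℤ) - c.1) ?_ ?_ ?_
  · intro c hc
    simp only [Finset.mem_filter, YoungDiagram.mem_cells, mem_staircase] at hc
    simp only [DyckPath.valleys, Finset.mem_filter, Finset.mem_Ioo]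
    push_cast
    exact ⟨⟨by omega, by omega⟩, hc.2.2⟩
  · intro c hc d hd h
    simp only [Finset.mem_filter, YoungDiagram.mem_cells, mem_staircase] at hc hd
    rw [← h] at hd
    exact Prod.ext (by omega) (by omega)
  · intro x hx
    simp only [DyckPath.valleys, Finset.mem_filter, Finset.mem_Ioo] at hx
    push_cast at hx
    obtain ⟨⟨h1, h2⟩, h3, h4⟩ := hx
    -- outside of `(-n, n)` the path is straight
    have hxn : x < n := by
      by_contra! h
      have e1 := hD.height_of_le l h (by omega)
      have e2 := hD.height_of_le l (x := x + 1) (by omega) (by omega)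
      omega
    have hxn' : -(n : ℤ) < x := by
      by_contra! h
      have e1 := hD.height_of_le_neg l h (by omega)
      have e2 := hD.height_of_le_neg l (x := x - 1) (by omega) (by omega)
      omega
    have p := (D l).height_parity (x := x) (by push_cast; omega) (by push_cast; omega)
    have b := hD.two_mul_le_height (x := x) (by omega) (by omega) l
    have b1 := (D l).height_le (x := x + 1) (by push_cast; omega) (by push_cast; omega)
    have b2 := (D l).height_le (x := x - 1) (by push_cast; omega) (by push_cast; omega)
    push_cast at p b1 b2
    obtain ⟨i, hi⟩ : ∃ i : ℕ, 2 * (i : ℤ) = n + 2 * l - 2 - (D l).height x - x :=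
      ⟨((n + 2 * l - 2 - (D l).height x - x) / 2).toNat, by omega⟩
    obtain ⟨j, hj⟩ : ∃ j : ℕ, (j : ℤ) = x + i := ⟨(x + i).toNat, by omega⟩
    have e : (j : ℤ) - i = x := by omega
    refine ⟨(i, j), ?_, e⟩
    simp only [Finset.mem_filter, YoungDiagram.mem_cells, mem_staircase, e]
    exact ⟨by omega, by omega, h3, h4⟩

/-- Each path contributes one to the drop at a cell for a valley at the bottom of this cell. -/
theorem outerDrops_pathFilling (hD : IsNested D) :
    outerDrops n k (pathFilling D) = ∑ l, (D l).valleys.card := by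
  rw [← Finset.sum_congr rfl fun l _ => hD.card_valleys l, ← sum_card_filter_comm, outerDrops]
  refine Finset.sum_congr rfl fun c hc => ?_
  rw [YoungDiagram.mem_cells, mem_staircase] at hc
  rw [hD.extendBy_pathFilling (by omega) (by omega) (by omega),
    hD.extendBy_pathFilling (by omega) (by omega) (by omega), pathFilling,
    if_pos ⟨by omega, by omega, by omega⟩, hD.min_card_pathsAbove_sub hc]

theorem card_pathsAbove_sub (D : (l : Fin k) → DyckPath (n + 2 * (l : ℕ))) {c : ℕ × ℕ}
    (hc : c.1 + c.2 + 1 < n) (hp : (c.1 + c.2) % 2 = n % 2) :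
    pathFilling D (c.1 + 1) (c.2 + 1) - pathFilling D c.1 (c.2 + 1) =
    (Finset.univ.filter fun l : Fin k => (D l).height (c.2 - c.1) + c.1 + c.2 = n + 2 * l ∧
      (D l).height (c.2 - c.1 + 1) < (D l).height (c.2 - c.1)).card := by
  have e : pathFilling D c.1 (c.2 + 1) = (pathsAbove D c.1 (c.2 + 1)).card := by
    by_cases h0 : c.1 = 0
    · rw [pathFilling, if_neg (by omega), eq_comm, Finset.card_eq_zero,
        Finset.eq_empty_iff_forall_notMem]
      intro l hl
      rw [mem_pathsAbove] at hl
      have := ((D l).height_le (x := (c.2 + 1 : ℕ) - c.1) (by push_cast; omega)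
        (by push_cast; omega)).2
      push_cast at this hl
      omega
    · rw [pathFilling, if_pos ⟨by omega, by omega, by omega⟩]
  rw [e, pathFilling, if_pos ⟨by omega, by omega, by omega⟩, ← Finset.card_sdiff_of_subset
    (pathsAbove_subset_left D (by omega) (by omega))]
  congr 1
  ext l
  have p := (D l).height_parity (x := c.2 - c.1) (by push_cast; omega) (by push_cast; omega)
  have t2 := (D l).step_right (x := c.2 - c.1) (by push_cast; omega) (by push_cast; omega)
  simp only [Finset.mem_sdiff, mem_pathsAbove, Finset.mem_filter, Finset.mem_univ, true_and]
  push_cast at p ⊢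
  rw [show (c.2 : ℤ) + 1 - c.1 = c.2 - c.1 + 1 by ring,
    show (c.2 : ℤ) + 1 - (c.1 + 1) = c.2 - c.1 by ring]
  omega

theorem card_evenDowns (hD : IsNested D) (l : Fin k) :
    (((staircase n).cells.filter fun c : ℕ × ℕ => (c.1 + c.2) % 2 = n % 2).filter
      fun c : ℕ × ℕ => (D l).height (c.2 - c.1) + c.1 + c.2 = n + 2 * l ∧
      (D l).height (c.2 - c.1 + 1) < (D l).height (c.2 - c.1)).card = evenDowns n (D l) := by
  refine Finset.card_bij (fun c _ => (n + c.2 - c.1) / 2) ?_ ?_ ?_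
  · intro c hc
    simp only [Finset.mem_filter, YoungDiagram.mem_cells, mem_staircase] at hc
    simp only [Finset.mem_filter, Finset.mem_range]
    rw [show -(n : ℤ) + 2 * ((n + c.2 - c.1) / 2 : ℕ) = c.2 - c.1 by omega]
    exact ⟨by omega, hc.2.2⟩
  · intro c hc d hd h
    simp only [Finset.mem_filter, YoungDiagram.mem_cells, mem_staircase] at hc hd
    have e : (c.2 : ℤ) - c.1 = d.2 - d.1 := by omega
    rw [← e] at hd
    exact Prod.ext (by omega) (by omega)
  · intro t ht
    simp only [Finset.mem_filter, Finset.mem_range] at ht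
    obtain ⟨h1, h2⟩ := ht
    obtain ⟨x, hx⟩ : ∃ x : ℤ, -(n : ℤ) + 2 * t = x := ⟨_, rfl⟩
    rw [hx] at h2
    have p := (D l).height_parity (x := x) (by push_cast; omega) (by push_cast; omega)
    have b := hD.two_mul_le_height (x := x + 1) (by omega) (by omega) l
    have b1 := (D l).height_le (x := x) (by push_cast; omega) (by push_cast; omega)
    have b2 := (D l).step_right (x := x) (by push_cast; omega) (by push_cast; omega)
    push_cast at p b1
    obtain ⟨i, hi⟩ : ∃ i : ℕ, 2 * (i : ℤ) = n + 2 * l - (D l).height x - x :=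
      ⟨((n + 2 * l - (D l).height x - x) / 2).toNat, by omega⟩
    obtain ⟨j, hj⟩ : ∃ j : ℕ, (j : ℤ) = x + i := ⟨(x + i).toNat, by omega⟩
    have e : (j : ℤ) - i = x := by omega
    refine ⟨(i, j), ?_, by simp only; omega⟩
    simp only [Finset.mem_filter, YoungDiagram.mem_cells, mem_staircase, e]
    exact ⟨⟨by omega, by omega⟩, by omega, h2⟩

/-- Each path contributes one to the difference of the entries of two adjacent cells for a down step
between them. -/
theorem alternatingSum_pathFilling (hD : IsNested D) :
    alternatingSum n (pathFilling D) = ∑ l, evenDowns n (D l) := by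
  rw [← Finset.sum_congr rfl fun l _ => hD.card_evenDowns l, ← sum_card_filter_comm,
    alternatingSum]
  refine Finset.sum_congr rfl fun c hc => ?_
  rw [Finset.mem_filter, YoungDiagram.mem_cells, mem_staircase] at hc
  exact card_pathsAbove_sub D hc.1 hc.2

end IsNested

theorem sum_pow_valleys {R : Type*} [CommSemiring R] (q : R) (n k : ℕ) :
    ∑ D ∈ nonIntersectingDyckPaths n k, q ^ ∑ l, (D l).valleys.card =
      ∑ f ∈ fillings n k, q ^ outerDrops n k f := by
  rw [← sum_nonIntersectingDyckPaths]
  refine Finset.sum_congr rfl fun D hD => ?_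
  rw [(mem_nonIntersectingDyckPaths.mp hD).outerDrops_pathFilling]

theorem sum_pow_evenDowns {R : Type*} [CommSemiring R] (q : R) (n k : ℕ) :
    ∑ D ∈ nonIntersectingDyckPaths n k, q ^ ∑ l, evenDowns n (D l) =
      ∑ f ∈ fillings n k, q ^ alternatingSum n f := by
  rw [← sum_nonIntersectingDyckPaths]
  refine Finset.sum_congr rfl fun D hD => ?_
  rw [(mem_nonIntersectingDyckPaths.mp hD).alternatingSum_pathFilling]

/-- On nested Dyck paths, the total number of valleys and the total number of down steps in even
position are equidistributed. -/
theorem sum_pow_valleys_eq_sum_pow_evenDowns {R : Type*} [CommSemiring R] (q : R) (n k : ℕ) :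
    ∑ D ∈ nonIntersectingDyckPaths n k, q ^ ∑ l, (D l).valleys.card =
      ∑ D ∈ nonIntersectingDyckPaths n k, q ^ ∑ l, evenDowns n (D l) := by
  rw [sum_pow_valleys, sum_pow_evenDowns, sum_pow_alternatingSum, sum_pow_innerJumps]

/-! ### Transfer operators and determinants -/

section Transfer

variable {R : Type*} [CommRing R]

/-- The weight of a half step from `y'` to `y` at time `s`: at even times stay (weight `1`) or
go down by one (weight `q`), at odd times stay or go up by one. -/
def stepWeight (q : R) (s y' y : ℕ) : R :=
  if y' = y then 1 else if s % 2 = 0 then (if y' = y + 1 then q else 0)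
    else (if y' + 1 = y then 1 else 0)

/-- The total weight of the walks in `ℕ` from `0` to `y` with `s` half steps. -/
def walkWeight (q : R) : ℕ → ℕ → R
  | 0, y => if y = 0 then 1 else 0
  | s + 1, y => if s % 2 = 0 then walkWeight q s y + q * walkWeight q s (y + 1)
      else walkWeight q s y + if y = 0 then 0 else walkWeight q s (y - 1)

/-- A walk with `s` half steps can go up only at the odd times. -/
theorem walkWeight_eq_zero (q : R) (s : ℕ) : ∀ y, s < 2 * y → walkWeight q s y = 0 := by
  induction s with
  | zero => intro y hy; exact if_neg (by omega)
  | succ s ih =>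
    intro y hy
    rw [walkWeight]
    split_ifs with h1 h2
    · rw [ih y (by omega), ih (y + 1) (by omega), mul_zero, add_zero]
    · omega
    · rw [ih y (by omega), ih (y - 1) (by omega), add_zero]

theorem walkWeight_two_mul_self (q : R) (i : ℕ) : walkWeight q (2 * i) i = 1 := by
  induction i with
  | zero => exact if_pos rfl
  | succ i ih =>
    rw [show 2 * (i + 1) = 2 * i + 1 + 1 by ring, walkWeight, if_neg (by omega),
      if_neg (by omega), walkWeight_eq_zero q (2 * i + 1) (i + 1) (by omega), Nat.add_sub_cancel,
      walkWeight, if_pos (by omega), ih, walkWeight_eq_zero q (2 * i) (i + 1) (by omega)]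
    simp

theorem walkWeight_succ_eq_sum (q : R) {N : ℕ} (s : ℕ)
    (hN : ∀ y, N ≤ y → walkWeight q s y = 0) {y : ℕ} (hy : y < N) :
    walkWeight q (s + 1) y = ∑ y' : Fin N, walkWeight q s y' * stepWeight q s y' y := by
  rw [Fin.sum_univ_eq_sum_range fun y' => walkWeight q s y' * stepWeight q s y' y]
  have split : ∀ y', walkWeight q s y' * stepWeight q s y' y =
      (if y' = y then walkWeight q s y' else 0) +
        if s % 2 = 0 then (if y' = y + 1 then walkWeight q s y' * q else 0)
        else (if y' + 1 = y then walkWeight q s y' else 0) := by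
    intro y'
    rw [stepWeight]
    split_ifs <;> first | omega | simp
  rw [Finset.sum_congr rfl fun y' _ => split y', Finset.sum_add_distrib, Finset.sum_ite_eq',
    if_pos (Finset.mem_range.mpr hy), walkWeight]
  split_ifs with h1 h2
  · rw [Finset.sum_ite_eq']
    split_ifs with h3
    · rw [mul_comm]
    · rw [Finset.mem_range, not_lt] at h3
      rw [hN _ h3, mul_zero]
  · rw [Finset.sum_eq_zero fun y' _ => if_neg (by omega)]
  · rw [Finset.sum_eq_single_of_mem (y - 1) (Finset.mem_range.mpr (by omega))
      fun y' _ h => if_neg (by omega), if_pos (by omega)]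

/-- The minor of walk weights whose `i`-th row consists of the walks with `2 * i + s` half
steps, and whose columns are given by `b`. -/
def walkMinor (q : R) {k : ℕ} (s : ℕ) (b : Fin k → ℕ) : R :=
  (Matrix.of fun i j : Fin k => walkWeight q (2 * i + s) (b j)).det

/-- Multilinear expansion of the minor along one half step of all walks. -/
theorem walkMinor_succ (q : R) {k N : ℕ} (s : ℕ) (hN : ∀ i < k, 2 * i + s < 2 * N)
    (b : Fin k → Fin N) : walkMinor q (s + 1) (fun j => (b j : ℕ)) =
      ∑ b' : Fin k → Fin N,
        walkMinor q s (fun j => (b' j : ℕ)) * ∏ j, stepWeight q s (b' j) (b j) := by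
  have e : (Matrix.of fun i j : Fin k => walkWeight q (2 * i + (s + 1)) (b j)).transpose =
      fun j => ∑ y' : Fin N, stepWeight q s y' (b j) •
        fun i : Fin k => walkWeight q (2 * i + s) y' := by
    funext j i
    rw [Finset.sum_apply, Matrix.transpose_apply, Matrix.of_apply, ← add_assoc,
      walkWeight_succ_eq_sum q (N := N) _ (fun y hy => walkWeight_eq_zero q _ _ (by
        have := hN i i.2; omega)) (b j).2]
    refine Finset.sum_congr rfl fun y' _ => ?_
    rw [Pi.smul_apply, smul_eq_mul, mul_comm]
    congr 1
    simp only [stepWeight]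
    rw [show (2 * (i : ℕ) + s) % 2 = s % 2 by omega]
  rw [walkMinor, ← Matrix.det_transpose, e]
  change Matrix.detRowAlternating.toMultilinearMap _ = _
  rw [MultilinearMap.map_sum]
  refine Finset.sum_congr rfl fun b' _ => ?_
  rw [MultilinearMap.map_smul_univ, smul_eq_mul, mul_comm]
  congr 1
  rw [walkMinor, ← Matrix.det_transpose]
  rfl

theorem walkMinor_eq_zero_of_not_injective (q : R) {k : ℕ} (s : ℕ) {b : Fin k → ℕ}
    (hb : ¬ Function.Injective b) : walkMinor q s b = 0 := by
  rw [Function.not_injective_iff] at hb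
  obtain ⟨i, j, hij, hne⟩ := hb
  refine Matrix.det_zero_of_column_eq hne fun l => ?_
  simp [hij]

theorem strictMono_add_le {k : ℕ} {b : Fin k → ℕ} (hb : StrictMono b) (d : ℕ) :
    ∀ i j : Fin k, (j : ℕ) = i + d → b i + d ≤ b j := by
  induction d with
  | zero =>
    intro i j h
    obtain rfl : i = j := Fin.ext (by omega)
    simp
  | succ d ih =>
    intro i j h
    have hj := j.2
    have h1 := ih i ⟨i + d, by omega⟩ rfl
    have h2 := hb (show (⟨i + d, by omega⟩ : Fin k) < j from Fin.lt_def.mpr (by simp only; omega))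
    omega

theorem strictMono_le {k : ℕ} {b : Fin k → ℕ} (hb : StrictMono b) (j : Fin k) : (j : ℕ) ≤ b j := by
  have := strictMono_add_le hb j ⟨0, by have := j.2; omega⟩ j (by simp)
  omega

/-- At time `0`, only the columns `0, 1, …, k - 1` contribute. -/
theorem walkMinor_zero (q : R) {k : ℕ} {b : Fin k → ℕ} (hb : StrictMono b) :
    walkMinor q 0 b = if ∀ j, b j = j then 1 else 0 := by
  split_ifs with h
  · rw [walkMinor, Matrix.det_of_isLowerTriangular]
    · refine Finset.prod_eq_one fun i _ => ?_
      rw [Matrix.of_apply, h, add_zero, walkWeight_two_mul_self]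
    · intro i j hij
      rw [OrderDual.toDual_lt_toDual, Fin.lt_def] at hij
      rw [Matrix.of_apply, h, walkWeight_eq_zero q _ _ (by omega)]
  · push Not at h
    obtain ⟨j, hj⟩ := h
    have hjk := j.2
    have h1 := strictMono_le hb j
    have h2 := strictMono_add_le hb (k - 1 - j) j ⟨k - 1, by omega⟩ (by simp only; omega)
    refine Matrix.det_eq_zero_of_column_eq_zero ⟨k - 1, by omega⟩ fun i => ?_
    have := i.2
    rw [Matrix.of_apply, walkWeight_eq_zero q _ _ (by omega)]

theorem strictMono_of_stepWeight_ne_zero (q : R) {k s : ℕ} {b b' : Fin k → ℕ} (hb : StrictMono b)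
    (hinj : Function.Injective b') (h : ∀ j, stepWeight q s (b' j) (b j) ≠ 0) :
    StrictMono b' := by
  have key : ∀ j, b' j = b j ∨ (s % 2 = 0 ∧ b' j = b j + 1) ∨ (s % 2 = 1 ∧ b' j + 1 = b j) := by
    intro j
    have := h j
    rw [stepWeight] at this
    split_ifs at this <;> first | omega | exact absurd rfl this
  intro i j hij
  have h1 := hb hij
  have h2 := key i
  have h3 := key j
  have h4 : b' i ≠ b' j := fun e => hij.ne (hinj e)
  omega

open Classical in
/-- In the expansion along a half step only strictly increasing columns survive: particles that
keep distance cannot overtake each other in a half step, and when they meet, two columns agree. -/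
theorem strictMono_walkMinor_succ (q : R) {k N : ℕ} (s : ℕ) (hN : ∀ i < k, 2 * i + s < 2 * N)
    (b : Fin k → Fin N) :
    (if StrictMono b then walkMinor q (s + 1) (fun j => (b j : ℕ)) else 0) =
      ∑ b' : Fin k → Fin N, (if StrictMono b' then walkMinor q s (fun j => (b' j : ℕ)) else 0) *
        if StrictMono b then ∏ j, stepWeight q s (b' j) (b j) else 0 := by
  split_ifs with hb
  · rw [walkMinor_succ q s hN]
    refine Finset.sum_congr rfl fun b' _ => ?_
    split_ifs with hb'
    · rfl
    rw [zero_mul]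
    by_cases hinj : Function.Injective fun j => (b' j : ℕ)
    · by_contra hne
      refine hb' fun i j hij => ?_
      refine strictMono_of_stepWeight_ne_zero q (s := s) (b := fun j => (b j : ℕ))
        (fun i j h => hb h) hinj (fun j hj => hne ?_) hij
      rw [Finset.prod_eq_zero (Finset.mem_univ j) hj, mul_zero]
    · rw [walkMinor_eq_zero_of_not_injective q s hinj, zero_mul]
  · simp

/-- An iterated transfer of weights, expanded as a sum over all sequences of states. -/
theorem sum_transfer_eq {C : Type*} [Fintype C] (v : ℕ → C → R) (M : ℕ → C → C → R) (S : ℕ)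
    (hv : ∀ s < S, ∀ b, v (s + 1) b = ∑ b', v s b' * M s b' b) :
    ∀ φ : C → R, ∑ b, v S b * φ b = ∑ H : Fin (S + 1) → C,
      v 0 (H 0) * (∏ t : Fin S, M t (H t.castSucc) (H t.succ)) * φ (H (Fin.last S)) := by
  induction S with
  | zero =>
    intro φ
    rw [← (Equiv.funUnique (Fin 1) C).symm.sum_comp]
    simp
  | succ S ih =>
    intro φ
    have ih' := ih (fun s hs => hv s (by omega)) fun b' => ∑ b, M S b' b * φ b
    rw [← (Fin.snocEquiv fun _ : Fin (S + 2) => C).sum_comp, Fintype.sum_prod_type,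
      Finset.sum_comm]
    calc ∑ b, v (S + 1) b * φ b = ∑ b', v S b' * ∑ b, M S b' b * φ b := by
          simp_rw [hv S (Nat.lt_succ_self S), Finset.sum_mul, Finset.mul_sum]
          rw [Finset.sum_comm]
          simp_rw [mul_assoc]
      _ = _ := by
          rw [ih']
          refine Finset.sum_congr rfl fun H _ => ?_
          rw [Finset.mul_sum]
          refine Finset.sum_congr rfl fun b _ => ?_
          rw [Fin.prod_univ_castSucc]
          simp only [Fin.snocEquiv_apply, Fin.snoc_castSucc, Fin.val_castSucc, Fin.val_last,
            Fin.succ_last, Fin.snoc_last, ← Fin.castSucc_succ, mul_assoc]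
          congr 2

end Transfer

/-! ### Walks of particles as nested Dyck paths -/

/-- Particles at the positions `p t l`, `t = 0, …, 2 * n`, that keep their order, start and end in
`0, …, k - 1`, and make steps as in `stepWeight`, trace out nested Dyck paths: the `l`-th path
has height `2 * p t l` or `2 * p t l + 1` at `x = t - n`, according to the parity of `t`. -/
theorem exists_isNested_of_walk {n k : ℕ} (p : ℕ → Fin k → ℕ) (h0 : ∀ l, p 0 l = l)
    (hlast : ∀ l, p (2 * n) l = l) (hmono : ∀ t ≤ 2 * n, StrictMono (p t))
    (hstep : ∀ t < 2 * n, ∀ l, p t l = p (t + 1) l ∨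
      (t % 2 = 0 ∧ p t l = p (t + 1) l + 1) ∨ (t % 2 = 1 ∧ p t l + 1 = p (t + 1) l)) :
    ∃ D : (l : Fin k) → DyckPath (n + 2 * (l : ℕ)), IsNested D ∧
      ∀ t ≤ 2 * n, ∀ l, (D l).height (-(n : ℤ) + t) = 2 * p t l + t % 2 := by
  have hle : ∀ t ≤ 2 * n, ∀ l : Fin k, (l : ℕ) ≤ p t l := fun t ht l => strictMono_le (hmono t ht) l
  let E : Fin k → DyckPath n := fun l =>
    { height := fun x => if |x| ≤ n then
        2 * p (x + n).toNat l + (x + n).toNat % 2 - 2 * l else 0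
      height_eq_zero := by
        intro x hx
        split_ifs with h
        · rcases abs_cases x with h' | h'
          · rw [show (x + n).toNat = 2 * n by omega, hlast]
            omega
          · rw [show (x + n).toNat = 0 by omega, h0]
            omega
        · rfl
      step := by
        intro x h1 h2
        rw [if_pos (abs_le.mpr ⟨by omega, by omega⟩), if_pos (abs_le.mpr ⟨by omega, by omega⟩),
          show (x + 1 + n).toNat = (x + n).toNat + 1 by omega]
        have := hstep (x + n).toNat (by omega) l
        have := hle (x + n).toNat (by omega) l
        have := hle ((x + n).toNat + 1) (by omega) l
        omega }
  refine ⟨fun l => (E l).raise l, isNested_raise E ?_, ?_⟩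
  · intro l m hlm x
    change (if |x| ≤ n then _ else _) ≤ (if |x| ≤ n then _ else _)
    split_ifs with h
    · obtain ⟨h1, h2⟩ := abs_le.mp h
      rw [Fin.lt_def] at hlm
      have := strictMono_add_le (hmono (x + n).toNat (by omega)) (m - l) l m (by omega)
      omega
    · exact le_rfl
  · intro t ht l
    have hx : |-(n : ℤ) + t| ≤ n := abs_le.mpr ⟨by omega, by omega⟩
    rw [DyckPath.height_raise _ _ hx]
    change 2 * (l : ℕ) + (if |-(n : ℤ) + t| ≤ n then _ else _) = _
    rw [if_pos hx, show (-(n : ℤ) + t + n).toNat = t by omega]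
    have := hle t ht l
    omega

theorem prod_range_two_mul {M : Type*} [CommMonoid M] (g : ℕ → M) (n : ℕ) :
    ∏ t ∈ Finset.range (2 * n), g t = ∏ t ∈ Finset.range n, (g (2 * t) * g (2 * t + 1)) := by
  induction n with
  | zero => simp
  | succ n ih =>
    rw [show 2 * (n + 1) = 2 * n + 1 + 1 by ring, Finset.prod_range_succ, Finset.prod_range_succ,
      Finset.prod_range_succ, ih, mul_assoc]

section Transfer

variable {R : Type*} [CommRing R]

theorem DyckPath.height_half_lt {n k : ℕ} {l : Fin k} (D : DyckPath (n + 2 * (l : ℕ)))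
    (t : Fin (2 * n + 1)) : D.height (-(n : ℤ) + t) / 2 < n + k := by
  have := t.2
  have := l.2
  have := (D.height_le (x := -(n : ℤ) + t) (by push_cast; omega) (by push_cast; omega)).1
  push_cast at this
  omega

/-- The positions of the particles that trace out the paths `D`. -/
def halfHeights {n k : ℕ} (D : (l : Fin k) → DyckPath (n + 2 * (l : ℕ))) (t : Fin (2 * n + 1))
    (l : Fin k) : Fin (n + k) :=
  ⟨(D l).height (-(n : ℤ) + t) / 2, (D l).height_half_lt t⟩

theorem IsNested.halfHeights_injective {n k : ℕ} {D D' : (l : Fin k) → DyckPath (n + 2 * (l : ℕ))}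
    (hD : IsNested D) (hD' : IsNested D') (h : halfHeights D = halfHeights D') : D = D' := by
  refine hD.pathFilling_injective hD' ?_
  have key : ∀ l, ∀ x : ℤ, -(n : ℤ) ≤ x → x ≤ n → (D l).height x = (D' l).height x := by
    intro l x h1 h2
    have e := congrArg Fin.val (congrFun (congrFun h ⟨(x + n).toNat, by omega⟩) l)
    simp only [halfHeights, show -(n : ℤ) + ((x + n).toNat : ℕ) = x by omega] at e
    have p := (D l).height_parity (x := x) (by push_cast; omega) (by push_cast; omega)
    have p' := (D' l).height_parity (x := x) (by push_cast; omega) (by push_cast; omega)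
    omega
  funext i j
  rw [pathFilling, pathFilling]
  split_ifs with hij
  · congr 1
    ext l
    rw [mem_pathsAbove, mem_pathsAbove, key l _ (by omega) (by omega)]
  · rfl

theorem IsNested.strictMono_halfHeights {n k : ℕ} {D : (l : Fin k) → DyckPath (n + 2 * (l : ℕ))}
    (hD : IsNested D) (t : Fin (2 * n + 1)) : StrictMono (halfHeights D t) := by
  intro l m hlm
  have := t.2
  have e := hD.height_add_le (x := -(n : ℤ) + t) (by omega) (by omega) (m - l) l m
    (by rw [Fin.lt_def] at hlm; omega)
  rw [Fin.lt_def] at *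
  simp only [halfHeights]
  omega

theorem prod_stepWeight_halfHeights {n k : ℕ} {D : (l : Fin k) → DyckPath (n + 2 * (l : ℕ))}
    (q : R) (l : Fin k) :
    ∏ t : Fin (2 * n), stepWeight q t (halfHeights D t.castSucc l) (halfHeights D t.succ l) =
      q ^ evenDowns n (D l) := by
  have e : ∀ t : Fin (2 * n), stepWeight q t (halfHeights D t.castSucc l)
      (halfHeights D t.succ l) = (fun t : ℕ => if t % 2 = 0 ∧
        (D l).height (-(n : ℤ) + t + 1) < (D l).height (-(n : ℤ) + t) then q else 1) t := by
    intro t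
    have ht := t.2
    have p := (D l).height_parity (x := -(n : ℤ) + t) (by push_cast; omega) (by push_cast; omega)
    have s := (D l).step_right (x := -(n : ℤ) + t) (by push_cast; omega) (by push_cast; omega)
    simp only [stepWeight, halfHeights, Fin.val_castSucc, Fin.val_succ]
    push_cast at p ⊢
    rw [← add_assoc]
    split_ifs <;> first | rfl | omega
  rw [Finset.prod_congr rfl fun t _ => e t, Fin.prod_univ_eq_prod_range (fun t : ℕ =>
    if t % 2 = 0 ∧ (D l).height (-(n : ℤ) + t + 1) < (D l).height (-(n : ℤ) + t) then q else 1),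
    prod_range_two_mul, evenDowns, ← Finset.prod_const, Finset.prod_filter]
  refine Finset.prod_congr rfl fun t _ => ?_
  rw [if_neg (c := (2 * t + 1) % 2 = 0 ∧ _) (by omega), mul_one]
  push_cast
  simp

/-- The Lindström–Gessel–Viennot expansion of the minor of walk weights. -/
theorem walkMinor_eq_sum (q : R) (n k : ℕ) : walkMinor q (2 * n) (fun j : Fin k => (j : ℕ)) =
    ∑ D ∈ nonIntersectingDyckPaths n k, q ^ ∑ l, evenDowns n (D l) := by
  classical
  have h := sum_transfer_eq (C := Fin k → Fin (n + k))
    (fun s b => if StrictMono b then walkMinor q s (fun j => (b j : ℕ)) else 0)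
    (fun s b' b => if StrictMono b then ∏ j, stepWeight q s (b' j) (b j) else 0) (2 * n)
    (fun s hs b => strictMono_walkMinor_succ q s (by omega) b)
    (fun b => if ∀ j, (b j : ℕ) = j then 1 else 0)
  have lhs : ∑ b : Fin k → Fin (n + k),
      (if StrictMono b then walkMinor q (2 * n) (fun j => (b j : ℕ)) else 0) *
        (if ∀ j, (b j : ℕ) = j then 1 else 0) =
      walkMinor q (2 * n) (fun j : Fin k => (j : ℕ)) := by
    have hid : StrictMono fun j : Fin k => (⟨j, by omega⟩ : Fin (n + k)) := fun i j hij => hij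
    rw [Finset.sum_eq_single_of_mem (fun j : Fin k => (⟨j, by omega⟩ : Fin (n + k)))
      (Finset.mem_univ _)]
    · rw [if_pos hid, if_pos fun j => rfl, mul_one]
    · intro b _ hb
      rw [if_neg (c := ∀ j, (b j : ℕ) = j) fun h => hb (funext fun j => Fin.ext (h j)), mul_zero]
  rw [← lhs, h]
  symm
  refine Finset.sum_of_injOn halfHeights ?_ (fun _ _ => Finset.mem_coe.mpr (Finset.mem_univ _))
    ?_ ?_
  · intro D hD D' hD' hDD'
    rw [Finset.mem_coe, mem_nonIntersectingDyckPaths] at hD hD'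
    exact hD.halfHeights_injective hD' hDD'
  · intro H _ hH
    by_contra hne
    refine hH ?_
    have hlast : ∀ j, (H (Fin.last (2 * n)) j : ℕ) = j := by
      by_contra hnot
      exact hne (by rw [if_neg hnot, mul_zero])
    rw [if_pos hlast, mul_one] at hne
    have hmono0 : StrictMono (H 0) := by
      by_contra hnot
      exact hne (by rw [if_neg hnot, zero_mul])
    have hzero : ∀ j, (H 0 j : ℕ) = j := by
      by_contra hnot
      refine hne ?_
      rw [if_pos hmono0, walkMinor_zero q (b := fun j => (H 0 j : ℕ)) (fun i j hij => hmono0 hij),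
        if_neg hnot, zero_mul]
    have hfac : ∀ t : Fin (2 * n), (if StrictMono (H t.succ) then
        ∏ j, stepWeight q t (H t.castSucc j) (H t.succ j) else 0) ≠ 0 := by
      intro t ht
      exact hne (by rw [Finset.prod_eq_zero (Finset.mem_univ t) ht, mul_zero])
    have hmono : ∀ t, StrictMono (H t) := by
      intro t
      refine Fin.cases hmono0 (fun t => ?_) t
      by_contra hnot
      exact hfac t (if_neg hnot)
    let p : ℕ → Fin k → ℕ := fun t l => if ht : t < 2 * n + 1 then (H ⟨t, ht⟩ l : ℕ) else 0
    have hp : ∀ t (ht : t < 2 * n + 1), p t = fun l => (H ⟨t, ht⟩ l : ℕ) := by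
      intro t ht
      funext l
      exact dif_pos ht
    obtain ⟨D, hD, hDp⟩ := exists_isNested_of_walk (n := n) p
      (fun l => by rw [hp 0 (by omega)]; exact hzero l)
      (fun l => by rw [hp (2 * n) (by omega)]; exact hlast l)
      (fun t ht => by rw [hp t (by omega)]; exact fun i j hij => hmono _ hij)
      (fun t ht l => by
        rw [hp t (by omega), hp (t + 1) (by omega)]
        have h1 := hfac ⟨t, ht⟩
        rw [if_pos (hmono _)] at h1
        have h2 : stepWeight q t (H ⟨t, by omega⟩ l) (H ⟨t + 1, by omega⟩ l) ≠ 0 := fun h0 =>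
          h1 (Finset.prod_eq_zero (Finset.mem_univ l) h0)
        rw [stepWeight] at h2
        simp only
        split_ifs at h2 <;> first | omega | exact absurd rfl h2)
    refine ⟨D, Finset.mem_coe.mpr (mem_nonIntersectingDyckPaths.mpr hD), ?_⟩
    funext t l
    refine Fin.ext ?_
    have := hDp t (by omega) l
    rw [hp t t.2] at this
    change _ = 2 * (H t l : ℕ) + _ at this
    change (D l).height (-(n : ℤ) + t) / 2 = (H t l : ℕ)
    omega
  · intro D hD
    rw [mem_nonIntersectingDyckPaths] at hD
    have hends : ∀ t : Fin (2 * n + 1), (t : ℕ) = 0 ∨ (t : ℕ) = 2 * n → ∀ j,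
        (halfHeights D t j : ℕ) = j := by
      intro t ht j
      simp only [halfHeights]
      rcases ht with ht | ht
      · have := hD.height_of_le_neg j (x := -(n : ℤ)) le_rfl (by omega)
        rw [ht, Nat.cast_zero, add_zero]
        omega
      · have := hD.height_of_le j (x := n) le_rfl (by omega)
        rw [ht, show -(n : ℤ) + (2 * n : ℕ) = n by push_cast; ring]
        omega
    rw [if_pos (hD.strictMono_halfHeights 0), walkMinor_zero q
      (b := fun j => (halfHeights D 0 j : ℕ)) (fun i j hij => hD.strictMono_halfHeights 0 hij),
      if_pos (hends 0 (Or.inl rfl)), if_pos (hends _ (Or.inr rfl)), one_mul, mul_one,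
      Finset.prod_congr rfl fun t _ => if_pos (hD.strictMono_halfHeights _), Finset.prod_comm,
      ← Finset.prod_pow_eq_pow_sum]
    exact (Finset.prod_congr rfl fun l _ => prod_stepWeight_halfHeights q l).symm

/-! ### The Hankel determinant -/

theorem nonIntersectingDyckPoly_eq_walkMinor (n k : ℕ) : nonIntersectingDyckPoly n k =
    walkMinor (Polynomial.X : Polynomial ℤ) (2 * n) (fun j : Fin k => (j : ℕ)) := by
  rw [walkMinor_eq_sum, nonIntersectingDyckPoly, sum_pow_valleys_eq_sum_pow_evenDowns]

theorem nonIntersectingDyckPoly_one (n : ℕ) : nonIntersectingDyckPoly n 1 = dyckPoly n := by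
  have e : nonIntersectingDyckPaths n 1 = Finset.univ := by
    refine Finset.eq_univ_of_forall fun D => mem_nonIntersectingDyckPaths.mpr fun i j hij => ?_
    exact absurd hij (by omega)
  rw [nonIntersectingDyckPoly, e, dyckPoly]
  refine Fintype.sum_equiv (Equiv.piUnique fun i : Fin 1 => DyckPath (n + 2 * (i : ℕ))) _ _
    fun D => ?_
  simp [Equiv.piUnique]

/-- The valley polynomial counts walks of a single particle that return to `0`. -/
theorem dyckPoly_eq_walkWeight (n : ℕ) :
    dyckPoly n = walkWeight (Polynomial.X : Polynomial ℤ) (2 * n) 0 := by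
  rw [← nonIntersectingDyckPoly_one, nonIntersectingDyckPoly_eq_walkMinor, walkMinor,
    Matrix.det_fin_one]
  simp

/-- The weights of the walks returning to `0` in `2 * j` further half steps form a column vector
`Q` supported on `0, …, j`, with last entry `q ^ j`. -/
theorem exists_return_weights (q : R) (j : ℕ) : ∃ Q : ℕ → R, Q j = q ^ j ∧ (∀ b, j < b → Q b = 0) ∧
    ∀ m, walkWeight q (2 * m + 2 * j) 0 =
      ∑ b ∈ Finset.range (j + 1), walkWeight q (2 * m) b * Q b := by
  induction j with
  | zero =>
    refine ⟨fun b => if b = 0 then 1 else 0, by simp, fun b hb => if_neg (by omega), ?_⟩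
    intro m
    simp
  | succ j ih =>
    obtain ⟨Q, h1, h2, h3⟩ := ih
    -- undo an up step, then a down step
    let P : ℕ → R := fun b => Q b + Q (b + 1)
    have hP : ∀ b, j < b → P b = 0 := fun b hb => by
      simp only [P, h2 b hb, h2 (b + 1) (by omega), add_zero]
    refine ⟨fun b => P b + if b = 0 then 0 else q * P (b - 1), ?_, ?_, ?_⟩
    · simp only [if_neg (Nat.succ_ne_zero j), Nat.add_sub_cancel, hP (j + 1) (by omega)]
      simp only [P, h1, h2 (j + 1) (by omega)]
      ring
    · intro b hb
      simp only [if_neg (show b ≠ 0 by omega), hP b (by omega), hP (b - 1) (by omega)]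
      ring
    · intro m
      have up : ∀ b, walkWeight q (2 * (m + 1)) b = walkWeight q (2 * m + 1) b +
          if b = 0 then 0 else walkWeight q (2 * m + 1) (b - 1) := by
        intro b
        rw [show 2 * (m + 1) = 2 * m + 1 + 1 by ring, walkWeight, if_neg (by omega)]
      have down : ∀ b, walkWeight q (2 * m + 1) b = walkWeight q (2 * m) b +
          q * walkWeight q (2 * m) (b + 1) := by
        intro b
        rw [walkWeight, if_pos (by omega)]
      have e1 : ∑ b ∈ Finset.range (j + 1), walkWeight q (2 * (m + 1)) b * Q b =
          ∑ b ∈ Finset.range (j + 1), walkWeight q (2 * m + 1) b * P b := by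
        simp only [up]
        simp only [add_mul, mul_add, P, Finset.sum_add_distrib]
        congr 1
        rw [Finset.sum_range_succ', Finset.sum_range_succ _ j, h2 (j + 1) (by omega)]
        simp
      have e2 : ∑ b ∈ Finset.range (j + 1), walkWeight q (2 * m + 1) b * P b =
          ∑ b ∈ Finset.range (j + 1 + 1), walkWeight q (2 * m) b *
            (P b + if b = 0 then 0 else q * P (b - 1)) := by
        simp only [down, add_mul, mul_add, Finset.sum_add_distrib]
        rw [Finset.sum_range_succ _ (j + 1), hP (j + 1) (by omega), mul_zero, add_zero]
        congr 1
        rw [Finset.sum_range_succ' _ (j + 1)]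
        simp [mul_assoc, mul_comm, mul_left_comm]
      rw [← e2, ← e1, ← h3 (m + 1)]
      congr 1
      ring

/-- Splitting each walk after `2 * (n + i)` half steps factors the Hankel matrix into a matrix of
walk weights and a triangular matrix with diagonal `q ^ j`. -/
theorem det_hankel_walkWeight (q : R) (n k : ℕ) :
    (Matrix.of fun i j : Fin k => walkWeight q (2 * (n + (i : ℕ) + (j : ℕ))) 0).det =
      q ^ k.choose 2 * walkMinor q (2 * n) (fun j : Fin k => (j : ℕ)) := by
  choose Q h1 h2 h3 using exists_return_weights q
  have e : (Matrix.of fun i j : Fin k => walkWeight q (2 * (n + (i : ℕ) + (j : ℕ))) 0) =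
      (Matrix.of fun i b : Fin k => walkWeight q (2 * i + 2 * n) b) *
        Matrix.of fun b j : Fin k => Q j b := by
    ext i j
    have hj := j.2
    rw [Matrix.mul_apply, Matrix.of_apply,
      show 2 * (n + (i : ℕ) + (j : ℕ)) = 2 * (i + n) + 2 * j by ring, h3]
    simp only [Matrix.of_apply]
    rw [Fin.sum_univ_eq_sum_range fun b => walkWeight q (2 * i + 2 * n) b * Q j b, ← mul_add]
    refine Finset.sum_subset (fun b hb => ?_) fun b _ hb => ?_
    · rw [Finset.mem_range] at *
      omega
    · rw [Finset.mem_range] at hb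
      rw [h2 _ _ (by omega), mul_zero]
  rw [e, Matrix.det_mul, Matrix.det_of_isUpperTriangular (M := Matrix.of fun b j : Fin k => Q j b),
    mul_comm]
  · congr 1
    simp only [Matrix.of_apply, h1]
    rw [Fin.prod_univ_eq_prod_range fun j => q ^ j, Finset.prod_pow_eq_pow_sum,
      Finset.sum_range_id, Nat.choose_two_right]
  · intro i j hij
    exact h2 _ _ hij

end Transfer

theorem det_hankel_dyckPoly (n k : ℕ) :
    (Matrix.of fun i j : Fin k => dyckPoly (n + (i : ℕ) + (j : ℕ))).det =
      Polynomial.X ^ k.choose 2 * nonIntersectingDyckPoly n k := by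
  rw [nonIntersectingDyckPoly_eq_walkMinor, ← det_hankel_walkWeight]
  simp only [dyckPoly_eq_walkWeight]

/-! ### Little Schröder numbers -/

section Schroder

variable {R : Type*} [CommRing R]

/-- The weights of the walks with `2 * m` half steps when the order of the two kinds of half steps
is interchanged: the up step comes first. -/
def swappedWeight (q : R) : ℕ → ℕ → R
  | 0, y => if y = 0 then 1 else 0
  | m + 1, y => (swappedWeight q m y + if y = 0 then 0 else swappedWeight q m (y - 1)) +
      q * (swappedWeight q m (y + 1) + swappedWeight q m y)

theorem walkWeight_two_mul_succ (q : R) (m y : ℕ) : walkWeight q (2 * (m + 1)) y =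
    (walkWeight q (2 * m) y + q * walkWeight q (2 * m) (y + 1)) +
      if y = 0 then 0 else walkWeight q (2 * m) (y - 1) + q * walkWeight q (2 * m) y := by
  rw [show 2 * (m + 1) = 2 * m + 1 + 1 by ring, walkWeight, if_neg (by omega), walkWeight,
    if_pos (by omega)]
  split_ifs with h
  · rfl
  · rw [walkWeight, if_pos (by omega), Nat.sub_add_cancel (by omega)]

/-- A walk of `m + 1` steps is a walk of `m` steps in the swapped order, except for its first
half step, which cannot go down, and its last one. -/
theorem walkWeight_eq_swappedWeight (q : R) (m : ℕ) : ∀ y, walkWeight q (2 * (m + 1)) y =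
    swappedWeight q m y + if y = 0 then 0 else swappedWeight q m (y - 1) := by
  induction m with
  | zero =>
    intro y
    rw [walkWeight_two_mul_succ]
    rcases y with _ | _ | y <;> simp [walkWeight, swappedWeight]
  | succ m ih =>
    intro y
    rw [walkWeight_two_mul_succ, ih, ih]
    rcases y with _ | y
    · simp [swappedWeight]
    · rw [ih]
      rcases y with _ | y <;> simp [swappedWeight]

theorem walkWeight_zero_eq_swappedWeight (q : R) (m : ℕ) :
    walkWeight q (2 * (m + 1)) 0 = swappedWeight q m 0 := by
  rw [walkWeight_eq_swappedWeight, if_pos rfl, add_zero]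

/-- Decomposition of a walk at its last visit to `0`. -/
theorem walkWeight_succ_eq_sum_swappedWeight (q : R) (m : ℕ) : ∀ y,
    walkWeight q (2 * m) (y + 1) = ∑ l ∈ Finset.range m,
      walkWeight q (2 * l) 0 * swappedWeight q (m - 1 - l) y := by
  induction m with
  | zero => intro y; simp [walkWeight]
  | succ m ih =>
    intro y
    have e : ∀ y, ∑ l ∈ Finset.range m,
        walkWeight q (2 * l) 0 * swappedWeight q (m - l) y =
        (walkWeight q (2 * m) (y + 1) + if y = 0 then 0 else walkWeight q (2 * m) y) +
          q * (walkWeight q (2 * m) (y + 2) + walkWeight q (2 * m) (y + 1)) := by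
      intro y
      rw [Finset.sum_congr rfl fun l hl => by
        rw [show m - l = (m - 1 - l) + 1 by have := Finset.mem_range.mp hl; omega, swappedWeight]]
      simp only [mul_add, Finset.sum_add_distrib, mul_left_comm _ q, ← Finset.mul_sum]
      rw [← ih, ← ih]
      split_ifs with h
      · simp
      · obtain ⟨z, rfl⟩ := Nat.exists_eq_succ_of_ne_zero h
        rw [Nat.succ_eq_add_one, Nat.add_sub_cancel, ← ih]
    rw [Finset.sum_range_succ, Nat.add_sub_cancel, e, walkWeight_two_mul_succ, Nat.sub_self]
    rcases y with _ | y
    · simp [swappedWeight]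
      ring
    · simp [swappedWeight]
      ring

theorem walkWeight_recurrence (q : R) (m : ℕ) : walkWeight q (2 * (m + 1)) 0 =
    walkWeight q (2 * m) 0 + q * ∑ l ∈ Finset.range m,
      walkWeight q (2 * l) 0 * walkWeight q (2 * (m - l)) 0 := by
  rw [walkWeight_two_mul_succ, if_pos rfl, add_zero, zero_add, ← zero_add 1,
    walkWeight_succ_eq_sum_swappedWeight]
  congr 2
  refine Finset.sum_congr rfl fun l hl => ?_
  rw [Finset.mem_range] at hl
  rw [← walkWeight_zero_eq_swappedWeight, show m - 1 - l + 1 = m - l by omega]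

end Schroder

/-- At `q = 1 / 2` the walk weights are little Schröder numbers, up to powers of `2`. -/
theorem littleSchroder_eq_walkWeight (m : ℕ) (hm : 1 ≤ m) :
    (littleSchroder m : ℚ) * 2 = 2 ^ m * walkWeight (1 / 2 : ℚ) (2 * m) 0 := by
  induction m using Nat.strong_induction_on with
  | _ m ih =>
    obtain ⟨m, rfl⟩ : ∃ r, m = r + 1 := ⟨m - 1, by omega⟩
    rcases Nat.eq_zero_or_pos m with rfl | hpos
    · simp [littleSchroder, walkWeight, Nat.smallSchroder]
    have h0 : walkWeight (1 / 2 : ℚ) (2 * 0) 0 = 1 := by simp [walkWeight]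
    have hm' := ih m (by omega) hpos
    rw [littleSchroder, Nat.smallSchroder_succ (by omega), walkWeight_recurrence,
      Finset.range_eq_Ico, Finset.sum_eq_sum_Ico_succ_bot hpos, h0, Nat.sub_zero]
    push_cast
    have e : 2 ^ m * ∑ l ∈ Finset.Ico (0 + 1) m, walkWeight (1 / 2 : ℚ) (2 * l) 0 *
        walkWeight (1 / 2 : ℚ) (2 * (m - l)) 0 = ∑ l ∈ Finset.Ioo 0 m,
        4 * ((Nat.smallSchroder (l + 1) : ℚ) * Nat.smallSchroder (m + 1 - l)) := by
      rw [Finset.mul_sum]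
      refine Finset.sum_congr (by ext; simp [Nat.succ_le_iff]) fun l hl => ?_
      rw [Finset.mem_Ioo] at hl
      have h1 := ih l (by omega) (by omega)
      have h2 := ih (m - l) (by omega) (by omega)
      rw [littleSchroder] at h1 h2
      rw [show m + 1 - l = m - l + 1 by omega]
      calc _ = (2 ^ l * walkWeight (1 / 2 : ℚ) (2 * l) 0) *
            (2 ^ (m - l) * walkWeight (1 / 2 : ℚ) (2 * (m - l)) 0) := by
            rw [show (2 : ℚ) ^ m = 2 ^ l * 2 ^ (m - l) by rw [← pow_add]; congr 1; omega]
            ring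
        _ = _ := by rw [← h1, ← h2]; ring
    rw [← Finset.mul_sum] at e
    rw [littleSchroder] at hm'
    rw [zero_add] at e
    rw [pow_succ]
    linear_combination 3 * hm' - e

theorem aeval_half_dyckPoly (m : ℕ) (hm : 1 ≤ m) :
    Polynomial.aeval (1 / 2 : ℚ) (dyckPoly m) * 2 ^ (2 * m + 1) = scaledSchroder m := by
  have map : ∀ s y, Polynomial.aeval (1 / 2 : ℚ) (walkWeight (Polynomial.X : Polynomial ℤ) s y) =
      walkWeight (1 / 2 : ℚ) s y := by
    intro s
    induction s with
    | zero => intro y; simp only [walkWeight]; split_ifs <;> simp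
    | succ s ih =>
      intro y
      simp only [walkWeight]
      split_ifs <;> simp only [map_add, map_mul, map_zero, Polynomial.aeval_X, ih]
  rw [dyckPoly_eq_walkWeight, map, scaledSchroder]
  push_cast
  have := littleSchroder_eq_walkWeight m hm
  rw [pow_add _ (2 * m), mul_comm 2 m, pow_mul, pow_add]
  rw [mul_comm m 2]
  linear_combination (-2 : ℚ) * 2 ^ m * this

/-! ### Conclusion -/

/-- The number of pleasant diagrams as a value of the polynomial of nested Dyck paths. -/
theorem numPleasant_eq_aeval (n k : ℕ) :
    (numPleasant (staircase (n + 2 * k)) (staircase n) : ℚ) * 2 ^ k =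
      2 ^ (2 * n * k + 2 * k ^ 2) *
        Polynomial.aeval (1 / 2 : ℚ) (nonIntersectingDyckPoly n k) := by
  rw [numPleasant_eq_mul_sum, nonIntersectingDyckPoly]
  simp only [map_sum, map_pow, Polynomial.aeval_X]
  rw [sum_pow_valleys, sum_pow_innerJumps]

theorem det_scaledSchroder (n k : ℕ) (hn : 1 ≤ n) :
    (Matrix.of fun i j : Fin k => (scaledSchroder (n + (i : ℕ) + (j : ℕ)) : ℚ)).det * 2 ^ k =
      2 ^ (2 * n * k + 2 * k ^ 2) *
        ((1 / 2) ^ k.choose 2 * Polynomial.aeval (1 / 2 : ℚ) (nonIntersectingDyckPoly n k)) := by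
  have h := congrArg (Polynomial.aeval (1 / 2 : ℚ)) (det_hankel_dyckPoly n k)
  rw [map_mul, map_pow, Polynomial.aeval_X] at h
  rw [← h, AlgHom.map_det]
  have e : (Matrix.of fun i j : Fin k => (scaledSchroder (n + (i : ℕ) + (j : ℕ)) : ℚ)) =
      Matrix.of fun i j : Fin k => (2 : ℚ) ^ (2 * (i : ℕ)) * Matrix.of (fun i j : Fin k =>
        (2 : ℚ) ^ (2 * n + 1 + 2 * (j : ℕ)) * (Polynomial.aeval (1 / 2 : ℚ)).mapMatrix
          (Matrix.of fun i j : Fin k => dyckPoly (n + (i : ℕ) + (j : ℕ))) i j) i j := by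
    ext i j
    simp only [Matrix.of_apply, AlgHom.mapMatrix_apply, Matrix.map_apply]
    rw [← aeval_half_dyckPoly _ (by omega)]
    ring
  rw [e, Matrix.det_mul_column, Matrix.det_mul_row, ← mul_assoc, mul_right_comm,
    Finset.prod_pow_eq_pow_sum, Finset.prod_pow_eq_pow_sum, ← pow_add, ← pow_add]
  congr 2
  rw [Finset.sum_add_distrib, ← Finset.mul_sum, Fin.sum_univ_eq_sum_range fun i => i]
  have := Finset.sum_range_id_mul_two k
  simp only [Finset.sum_const, Finset.card_univ, Fintype.card_fin, smul_eq_mul]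
  rcases k with _ | k
  · simp
  · rw [Nat.add_sub_cancel] at this
    nlinarith

theorem theorem1p1 (n k : ℕ) (hn : 1 ≤ n) :
    (numPleasant (staircase (n + 2 * k)) (staircase n) : ℤ) =
        2 ^ k.choose 2 *
          (Matrix.of fun i j : Fin k => (scaledSchroder (n + (i : ℕ) + (j : ℕ)) : ℤ)).det ∧
      (Matrix.of fun i j : Fin k => dyckPoly (n + (i : ℕ) + (j : ℕ))).det =
        Polynomial.X ^ k.choose 2 * nonIntersectingDyckPoly n k := by
  refine ⟨?_, det_hankel_dyckPoly n k⟩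
  have h1 := numPleasant_eq_aeval n k
  have h2 := det_scaledSchroder n k hn
  have h3 : ((Matrix.of fun i j : Fin k => (scaledSchroder (n + (i : ℕ) + (j : ℕ)) : ℤ)).det : ℚ) =
      (Matrix.of fun i j : Fin k => (scaledSchroder (n + (i : ℕ) + (j : ℕ)) : ℚ)).det := by
    rw [Int.cast_det]
    congr 1
  rw [← @Int.cast_inj ℚ]
  rw [Int.cast_mul, Int.cast_pow, Int.cast_ofNat, Int.cast_natCast, h3]
  refine mul_right_cancel₀ (b := (2 : ℚ) ^ k) (by positivity) ?_
  have hc : (2 : ℚ) ^ k.choose 2 * (1 / 2) ^ k.choose 2 = 1 := by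
    rw [← mul_pow]
    norm_num
  linear_combination h1 - 2 ^ k.choose 2 * h2 - 2 ^ (2 * n * k + 2 * k ^ 2) *
    Polynomial.aeval (1 / 2 : ℚ) (nonIntersectingDyckPoly n k) * hc
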